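/- Commutators are $[a,b]=a^{-1}b^{-1}ab$, and longer ones are left-normed: $[a_1,a_2,\dots,a_r]=[\dots[[a_1,a_2],a_3],\dots,a_r]$. For a finite group $G$, an integer $n\ge 1$ and an element $g\in G$ put $E_n(g)=\langle [x,\underbrace{g,\dots,g}_{n}]\mid x\in G\rangle$. For an automorphism $\alpha$ of $G$ put $[G,\alpha]=\langle [x,\alpha]\mid x\in G\rangle$ and $E_{G,n}(\alpha)=\langle [x,\underbrace{\alpha,\dots,\alpha}_{n}]\mid x\in G\rangle$, the commutators being taken in the semidirect product $G\langle\alpha\rangle$, so that $[x,\alpha]=x^{-1}x^{\alpha}$. The generalized Fitting subgroup $F^*(G)$ is the product of the Fitting subgroup $F(G)$ and all subnormal quasisimple subgroups of $G$ (a group $Q$ is quasisimple if $Q=[Q,Q]$ and $Q/Z(Q)$ is a nonabelian simple group). Let $F^*_0(G)=1$, let $F^*_{i+1}(G)$ be the inverse image of $F^*(G/F^*_i(G))$ in $G$, and let the generalized Fitting height $h^*(G)$ be the least $h$ with $F^*_h(G)=G$. The nonsoluble length $\lambda(G)$ is the minimum number of nonsoluble factors in a normal series of $G$ each of whose factors is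 either soluble or a direct product of nonabelian simple groups, and $R_i(G)$ is the largest normal subgroup of $G$ of nonsoluble length at most $i$. **Theorem.** Let $n$ be a positive integer. Assume that $E_{S,n}(\varphi)=S$ for every direct product $S=S_1\times\dots\times S_r$ of finitely many nonabelian finite simple groups and every nontrivial automorphism $\varphi$ of $S$ that transitively permutes the factors $S_1,\dots,S_r$. Then for every finite group $G$: 1. for every $g\in G$, if $h^*(E_n(g))=k$, then $g\in F^*_{k+1}(G)$; 2. for every $g\in G$, if $\lambda(E_n(g))=k$, then $g\in R_k(G)$; 3. for every automorphism $\alpha$ of $G$, if $G=[G,\alpha]$, then $E_{G,n}(\alpha)=G$. -/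

import Mathlib

universe u

namespace EngelSink

/-- A nonabelian simple group. -/
def IsNonabelianSimple (G : Type u) [Group G] : Prop :=
  IsSimpleGroup G ∧ ∃ a b : G, a * b ≠ b * a

/-! ### Engel commutators and the subgroups they generate

Commutators are `[a, b] = a⁻¹ b⁻¹ a b`, left-normed. For an automorphism `φ` of `G` the commutator
`[x, φ]` in the semidirect product of `G` and `⟨φ⟩`, where `φ⁻¹ x φ` is the image of `x` under `φ`,
is `x⁻¹ φ(x)`. -/

/-- `[x, g, …, g]` with `g` repeated `n` times. -/
def engelComm {G : Type u} [Group G] (g : G) (n : ℕ) (x : G) : G :=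
  (fun y : G => y⁻¹ * g⁻¹ * y * g)^[n] x

/-- `E_n(g)`, the subgroup generated by all `[x, g, …, g]` (`g` repeated `n` times), `x ∈ G`. -/
def engelSubgroup {G : Type u} [Group G] (g : G) (n : ℕ) : Subgroup G :=
  Subgroup.closure (Set.range (engelComm g n))

/-- `[x, φ, …, φ]` with the automorphism `φ` repeated `n` times. -/
def autEngelComm {G : Type u} [Group G] (φ : MulAut G) (n : ℕ) (x : G) : G :=
  (fun y : G => y⁻¹ * φ y)^[n] x

/-- `E_{G,n}(φ)`, the subgroup generated by all `[x, φ, …, φ]` (`φ` repeated `n` times), `x ∈ G`. -/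
def autEngelSubgroup {G : Type u} [Group G] (φ : MulAut G) (n : ℕ) : Subgroup G :=
  Subgroup.closure (Set.range (autEngelComm φ n))

/-- `[G, φ]`, the subgroup generated by all `[x, φ]`, `x ∈ G`. -/
def autCommutator {G : Type u} [Group G] (φ : MulAut G) : Subgroup G :=
  Subgroup.closure (Set.range fun x : G => x⁻¹ * φ x)

/-- The automorphism `φ` of the direct product of the groups `T i` transitively permutes the
factors: there is a transitive permutation `σ` of the indices such that `φ` maps the `i`-th factor
onto the `σ i`-th one. -/
def PermutesFactorsTransitively {r : ℕ} (T : Fin r → Type u) [∀ i, Group (T i)]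
    (φ : MulAut (∀ i, T i)) : Prop :=
  ∃ σ : Equiv.Perm (Fin r),
    (∀ i, (MonoidHom.mulSingle T i).range.map φ.toMonoidHom = (MonoidHom.mulSingle T (σ i)).range) ∧
      ∀ i j, σ.SameCycle i j

/-- `E_{S,n}(φ) = S` for every direct product `S` of finitely many nonabelian finite simple groups
and every nontrivial automorphism `φ` of `S` that transitively permutes the factors. (For a single
factor the identity permutes the factors transitively, but `E_{S,n}(1) = 1`.) -/
def EngelGeneratesSimpleProducts (n : ℕ) : Prop :=
  ∀ (r : ℕ) (T : Fin r → Type u) [∀ i, Group (T i)] [∀ i, Finite (T i)],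
    (∀ i, IsNonabelianSimple (T i)) →
      ∀ φ : MulAut (∀ i, T i), φ ≠ 1 → PermutesFactorsTransitively T φ →
        autEngelSubgroup φ n = ⊤

/-! ### The generalized Fitting series and height -/

/-- A group is quasisimple if it is equal to its derived subgroup and its quotient by the centre is
a nonabelian simple group. -/
def IsQuasisimple (Q : Type u) [Group Q] : Prop :=
  commutator Q = ⊤ ∧ IsNonabelianSimple (Q ⧸ Subgroup.center Q)

/-- The Fitting subgroup `F(G)`, generated by all nilpotent normal subgroups; for finite `G` it is
the largest nilpotent normal subgroup. -/
def fitting (G : Type u) [Group G] : Subgroup G :=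
  sSup {N : Subgroup G | N.Normal ∧ Group.IsNilpotent N}

/-- The generalized Fitting subgroup `F^*(G)`, the product of the Fitting subgroup and all
subnormal quasisimple subgroups. -/
def genFitting (G : Type u) [Group G] : Subgroup G :=
  fitting G ⊔ sSup {Q : Subgroup G | Q.IsSubnormal ∧ IsQuasisimple Q}

theorem IsNonabelianSimple.of_equiv {G H : Type u} [Group G] [Group H] (e : G ≃* H)
    (h : IsNonabelianSimple G) : IsNonabelianSimple H := by
  obtain ⟨hs, a, b, hab⟩ := h
  refine ⟨(MulEquiv.isSimpleGroup_congr e).1 hs, e a, e b, fun hc => hab ?_⟩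
  apply e.injective
  simpa using hc

theorem IsQuasisimple.of_equiv {G H : Type u} [Group G] [Group H] (e : G ≃* H)
    (h : IsQuasisimple G) : IsQuasisimple H := by
  refine ⟨?_, ?_⟩
  · have h1 := Subgroup.map_commutator (⊤ : Subgroup G) ⊤ e.toMonoidHom
    have h2 : (⊤ : Subgroup G).map e.toMonoidHom = ⊤ :=
      Subgroup.map_top_of_surjective _ e.surjective
    have h3 : ⁅(⊤ : Subgroup G), ⊤⁆ = ⊤ := h.1
    rw [h3, h2] at h1
    exact h1.symm
  · refine IsNonabelianSimple.of_equiv (QuotientGroup.congr _ _ e ?_) h.2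
    ext x
    simp only [Subgroup.mem_map, Subgroup.mem_center_iff]
    constructor
    · rintro ⟨y, hy, rfl⟩ z
      have := congrArg e (hy (e.symm z))
      simpa using this
    · intro hx
      refine ⟨e.symm x, fun z => ?_, by simp⟩
      apply e.injective
      simpa using hx (e z)

theorem sSup_normal_of_conj {G : Type u} [Group G] (A : Set (Subgroup G))
    (hA : ∀ Q ∈ A, ∀ g : G, Q.map (MulAut.conj g).toMonoidHom ∈ A) : (sSup A).Normal := by
  refine ⟨fun x hx g => ?_⟩
  have h : (sSup A).map (MulAut.conj g).toMonoidHom ≤ sSup A := by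
    rw [Subgroup.map_le_iff_le_comap]
    refine sSup_le fun Q hQ => ?_
    rw [← Subgroup.map_le_iff_le_comap]
    exact le_sSup (hA Q hQ g)
  exact h ⟨x, hx, rfl⟩

theorem genFitting_normal (G : Type u) [Group G] : (genFitting G).Normal := by
  have h1 : (fitting G).Normal := by
    refine sSup_normal_of_conj _ fun N hN g => ?_
    have := hN.1
    rwa [show N.map (MulAut.conj g).toMonoidHom = N from Subgroup.Normal.map_conj_eq ..]
  have h2 : (sSup {Q : Subgroup G | Q.IsSubnormal ∧ IsQuasisimple Q}).Normal := by
    refine sSup_normal_of_conj _ fun Q hQ g => ?_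
    exact ⟨hQ.1.map (MulAut.conj g).surjective,
      hQ.2.of_equiv (Q.equivMapOfInjective _ (MulAut.conj g).injective)⟩
  exact Subgroup.sup_normal _ _

/-- The generalized Fitting series, each term with a proof of its normality: it starts from `1`,
and each next term is the inverse image of `F^*` of the quotient by the previous one. -/
def genFittingSeriesAux (G : Type u) [Group G] : ℕ → {N : Subgroup G // N.Normal}
  | 0 => ⟨⊥, inferInstance⟩
  | i + 1 =>
    let N := genFittingSeriesAux G i
    haveI : N.1.Normal := N.2
    haveI : (genFitting (G ⧸ N.1)).Normal := genFitting_normal _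
    ⟨(genFitting (G ⧸ N.1)).comap (QuotientGroup.mk' N.1), inferInstance⟩

/-- The `i`-th term `F^*_i(G)` of the generalized Fitting series. -/
def genFittingSeries (G : Type u) [Group G] (i : ℕ) : Subgroup G :=
  (genFittingSeriesAux G i).1

/-- The generalized Fitting height `h^*(G)`, the least `h` with `F^*_h(G) = G`. -/
noncomputable def genFittingHeight (G : Type u) [Group G] : ℕ :=
  sInf {h : ℕ | genFittingSeries G h = ⊤}

/-! ### Nonsoluble length -/

/-- A direct product of finitely many nonabelian simple groups. -/
def IsProductOfNonabelianSimple (G : Type u) [Group G] : Prop :=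
  ∃ (r : ℕ) (T : Fin r → Type u) (_ : ∀ i, Group (T i)),
    (∀ i, IsNonabelianSimple (T i)) ∧ Nonempty (G ≃* ∀ i, T i)

/-- A normal series `1 = N_0 ≤ N_1 ≤ … ≤ N_l = G` of normal subgroups of `G`, each of whose
factors is soluble or a direct product of nonabelian simple groups. -/
structure SolubleSimpleSeries (G : Type u) [Group G] where
  /-- The length of the series. -/
  length : ℕ
  /-- The terms of the series; only those with index at most `length` matter. -/
  term : ℕ → Subgroup G
  normal : ∀ i, (term i).Normal
  mono : ∀ i < length, term i ≤ term (i + 1)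
  term_zero : term 0 = ⊥
  term_length : term length = ⊤
  factor : ∀ i < length,
    Group.IsSolvable (term (i + 1) ⧸ (term i).subgroupOf (term (i + 1))) ∨
      IsProductOfNonabelianSimple (term (i + 1) ⧸ (term i).subgroupOf (term (i + 1)))

open Classical in
/-- The number of nonsoluble factors of the series. -/
noncomputable def SolubleSimpleSeries.numNonsoluble {G : Type u} [Group G]
    (s : SolubleSimpleSeries G) : ℕ :=
  haveI := s.normal
  ((Finset.range s.length).filter fun i =>
    ¬ Group.IsSolvable (s.term (i + 1) ⧸ (s.term i).subgroupOf (s.term (i + 1)))).card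

/-- The nonsoluble length `λ(G)`, the minimum number of nonsoluble factors in a normal series each
of whose factors is soluble or a direct product of nonabelian simple groups. -/
noncomputable def nonsolubleLength (G : Type u) [Group G] : ℕ :=
  sInf (Set.range fun s : SolubleSimpleSeries G => s.numNonsoluble)

/-- The term `R_i(G)` of the upper nonsoluble series: the largest normal subgroup of `G` of
nonsoluble length at most `i`. -/
def nonsolubleRadical (G : Type u) [Group G] (i : ℕ) : Subgroup G :=
  sSup {N : Subgroup G | N.Normal ∧ nonsolubleLength N ≤ i}

end EngelSink

open EngelSink

open EngelSink
open scoped commutatorElement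

/-! Statements 1 and 2 reduce to statement 3. Given $g$, let $\alpha$ be conjugation by $g$, and let
$K$ be the term at which the chain $G\ge[G,\alpha]\ge[G,\alpha,\alpha]\ge\dots$ becomes stationary.
Each term is normal in the preceding one, so $K$ is subnormal; also $K=[K,\alpha]$, so statement 3
for $K$ gives $K=E_{K,n}(\alpha)\le E_n(g)$. Let $E_n(g)$ belong to a class closed under quotients,
normal subgroups and products of normal subgroups. Then so does $K$, and $K$ lies in the radical $R$
of $G$ for this class. Modulo $R$ the chain reaches $1$; adjoining $g$ to its terms gives a
subnormal chain ending in $\langle gR\rangle$, whence $gR\in F(G/R)$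
(`mk_mem_fitting_of_engelSubgroup`). With $R=F^*_k(G)$ and $F\le F^*$ this is statement 1. With
$R=R_k(G)$ it is statement 2, since $F(G/R_k(G))=1$: a soluble factor on top does not raise
nonsoluble length.

Statement 3 goes by induction on $|G|$ (`autEngelSubgroup_eq_top`). Put $E=E_{G,n}(\alpha)$ and
$C=C_G(\alpha)$. By induction $G=EM$ for every nontrivial $\alpha$-invariant normal subgroup $M$.
Since $C$ normalizes $E$, the equalities $G=EC$ and $G=[G,\alpha]$ force $E=G$. If $F(G)=1$, then
$F^*(G)$ is a product of nonabelian simple groups, and by the hypothesis on simple groups each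
$\alpha$-orbit of them lies in $E$ or in $C$; so $G=EF^*(G)=EC$. Otherwise take $M\le Z(F(G))$
minimal: either $M\le E$ or $G=EC$.

To identify both series with radicals, the relevant classes are built as iterated extensions of
Fitting formations (nilpotent, soluble, quasinilpotent), and such extensions are again Fitting
formations. -/

namespace EngelSink

/-! ### Fitting formations of finite groups and their radicals -/

/-- A class of groups whose finite members are closed under homomorphic images, normal subgroups
and products of normal subgroups. -/
structure IsFittingFormation (C : ∀ (G : Type u) [Group G], Prop) : Prop where
  of_subsingleton : ∀ (G : Type u) [Group G] [Subsingleton G], C G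
  of_surjective : ∀ {G H : Type u} [Group G] [Group H] [Finite G] (f : G →* H),
    Function.Surjective f → C G → C H
  of_normal : ∀ {G : Type u} [Group G] [Finite G] (N : Subgroup G) [N.Normal], C G → C N
  of_sup_eq_top : ∀ {G : Type u} [Group G] [Finite G] (M N : Subgroup G) [M.Normal] [N.Normal],
    C M → C N → M ⊔ N = ⊤ → C G

/-- The `C`-radical of a group, generated by all normal `C`-subgroups. -/
def radical (C : ∀ (G : Type u) [Group G], Prop) (G : Type u) [Group G] : Subgroup G :=
  sSup {N : Subgroup G | N.Normal ∧ C N}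

instance radical_normal (C : ∀ (G : Type u) [Group G], Prop) (G : Type u) [Group G] :
    (radical C G).Normal :=
  Subgroup.sSup_normal _ fun _ h => h.1

/-- The groups with a normal `C`-subgroup and a quotient by it in `D`. -/
def ExtensionClass (C D : ∀ (G : Type u) [Group G], Prop) (G : Type u) [Group G] : Prop :=
  ∃ (N : Subgroup G) (_ : N.Normal), C N ∧ D (G ⧸ N)

theorem normalizer_le_normalizer_map_of_characteristic {G : Type u} [Group G] (K : Subgroup G)
    (X : Subgroup K) [hX : X.Characteristic] :
    Subgroup.normalizer (K : Set G) ≤ Subgroup.normalizer (X.map K.subtype : Set G) := by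
  have key : ∀ g ∈ Subgroup.normalizer (K : Set G), ∀ h ∈ X.map K.subtype,
      g * h * g⁻¹ ∈ X.map K.subtype := by
    rintro g hg _ ⟨h, hh, rfl⟩
    have h1 := Subgroup.characteristic_iff_map_le.1 hX (K.normalizerMonoidHom ⟨g, hg⟩)
      (Subgroup.mem_map_of_mem _ hh)
    exact ⟨_, h1, rfl⟩
  intro g hg
  rw [Subgroup.mem_normalizer_iff]
  refine fun h => ⟨key g hg h, fun hh => ?_⟩
  have := key g⁻¹ (inv_mem hg) _ hh
  simpa [mul_assoc] using this

/-- The inverse image of a subgroup of a quotient group, modulo the kernel. -/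
noncomputable def comapQuotientEquiv {G : Type u} [Group G] (N : Subgroup G) [N.Normal]
    (K : Subgroup (G ⧸ N)) :
    (K.comap (QuotientGroup.mk' N)) ⧸ N.subgroupOf (K.comap (QuotientGroup.mk' N)) ≃* K :=
  have hker : N.subgroupOf (K.comap (QuotientGroup.mk' N)) =
      ((QuotientGroup.mk' N).subgroupComap K).ker := by
    ext x
    rw [MonoidHom.mem_ker, Subtype.ext_iff]
    exact (QuotientGroup.eq_one_iff (N := N) _).symm
  (QuotientGroup.quotientMulEquivOfEq hker).trans
    (QuotientGroup.quotientKerEquivOfSurjective _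
      (MonoidHom.subgroupComap_surjective_of_surjective (QuotientGroup.mk' N) K
        (QuotientGroup.mk'_surjective N)))

/-! ### Radicals, subnormal subgroups and extensions of Fitting formations -/

namespace IsFittingFormation

variable {C D : ∀ (G : Type u) [Group G], Prop} {G H : Type u} [Group G] [Group H] [Finite G]

theorem of_mulEquiv (hC : IsFittingFormation C) (e : G ≃* H) (h : C G) : C H :=
  hC.of_surjective e.toMonoidHom e.surjective h

theorem of_injective (hC : IsFittingFormation C) (f : H →* G) (hf : Function.Injective f)
    (hn : f.range.Normal) (h : C G) : C H :=
  hC.of_mulEquiv (MonoidHom.ofInjective hf).symm (hC.of_normal f.range h)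

theorem map (hC : IsFittingFormation C) (f : G →* H) (N : Subgroup G) (h : C N) :
    C (N.map f) :=
  hC.of_surjective (f.subgroupMap N) (f.subgroupMap_surjective N) h

theorem sup (hC : IsFittingFormation C) (M N : Subgroup G) [M.Normal] [N.Normal]
    (hM : C M) (hN : C N) : C ↥(M ⊔ N) := by
  refine hC.of_sup_eq_top (M.subgroupOf (M ⊔ N)) (N.subgroupOf (M ⊔ N))
    (hC.of_mulEquiv (Subgroup.subgroupOfEquivOfLe le_sup_left).symm hM)
    (hC.of_mulEquiv (Subgroup.subgroupOfEquivOfLe le_sup_right).symm hN) ?_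
  rw [← Subgroup.subgroupOf_sup le_sup_left le_sup_right, Subgroup.subgroupOf_self]

/-- A maximal normal `C`-subgroup absorbs every other one, because their product is again a normal
`C`-subgroup. -/
theorem radical_mem (hC : IsFittingFormation C) : C (radical C G) := by
  obtain ⟨N, hN⟩ := (Set.toFinite {N : Subgroup G | N.Normal ∧ C N}).exists_maximal
    ⟨⊥, inferInstance, hC.of_subsingleton _⟩
  have := hN.prop.1
  have h : radical C G = N := by
    refine le_antisymm (sSup_le fun M hM => ?_) (le_sSup hN.prop)
    have := hM.1
    exact le_sup_right.trans
      (hN.le_of_ge ⟨Subgroup.sup_normal N M, hC.sup N M hN.prop.2 hM.2⟩ le_sup_left)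
  rw [h]
  exact hN.prop.2

theorem radical_eq_top_iff (hC : IsFittingFormation C) : radical C G = ⊤ ↔ C G := by
  refine ⟨fun h => ?_, fun h => top_le_iff.1 (le_sSup ⟨inferInstance, ?_⟩)⟩
  · have := hC.radical_mem (G := G)
    rw [h] at this
    exact hC.of_mulEquiv Subgroup.topEquiv this
  · exact hC.of_mulEquiv Subgroup.topEquiv.symm h

theorem map_radical_le (hC : IsFittingFormation C) (f : G →* H) (hf : Function.Surjective f) :
    (radical C G).map f ≤ radical C H :=
  le_sSup ⟨Subgroup.Normal.map inferInstance f hf, hC.map f _ hC.radical_mem⟩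

theorem radical_characteristic (hC : IsFittingFormation C) : (radical C G).Characteristic :=
  Subgroup.characteristic_iff_map_le.2 fun e => hC.map_radical_le e.toMonoidHom e.surjective

theorem le_radical_of_isSubnormal (hC : IsFittingFormation C) {K : Subgroup G}
    (hK : K.IsSubnormal) (h : C K) : K ≤ radical C G := by
  -- The induction descends a subnormal chain from `G`. At a term `L` normal in `L'`, a subgroup `N`
  -- normal in `L` lies in the radical of `L`; this radical is characteristic in `L`, hence
  -- normalized by `L'`, and takes over the role of `N` one step higher.
  suffices key : ∀ L : Subgroup G, L.IsSubnormal → ∀ N ≤ L,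
      L ≤ Subgroup.normalizer (N : Set G) → C N → N ≤ radical C G from
    key K hK K le_rfl Subgroup.le_normalizer h
  intro L hL
  induction hL with
  | top =>
    intro N _ hN hCN
    exact le_sSup ⟨Subgroup.normalizer_eq_top_iff.1 (top_le_iff.1 hN), hCN⟩
  | step L L' hle _ hn ih =>
    intro N hNL hN hCN
    have hchar := hC.radical_characteristic (G := L)
    have h1 : (radical C L).map L.subtype ≤ radical C G := by
      refine ih _ ((Subgroup.map_subtype_le _).trans hle) ?_ (hC.map _ _ hC.radical_mem)
      exact ((Subgroup.normal_subgroupOf_iff_le_normalizer hle).1 hn).trans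
        (normalizer_le_normalizer_map_of_characteristic L _)
    have h2 : N.subgroupOf L ≤ radical C L :=
      le_sSup ⟨(Subgroup.normal_subgroupOf_iff_le_normalizer hNL).2 hN,
        hC.of_mulEquiv (Subgroup.subgroupOfEquivOfLe hNL).symm hCN⟩
    have h3 := (Subgroup.map_mono h2).trans h1
    rwa [Subgroup.map_subgroupOf_eq_of_le hNL] at h3

theorem of_isSubnormal (hC : IsFittingFormation C) {K : Subgroup G}
    (hK : K.IsSubnormal) (h : C G) : C K := by
  induction hK with
  | top => exact hC.of_mulEquiv Subgroup.topEquiv.symm h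
  | step K L hle _ hn ih =>
    exact hC.of_mulEquiv (Subgroup.subgroupOfEquivOfLe hle) (hC.of_normal (K.subgroupOf L) ih)

theorem quotient_of_le (hD : IsFittingFormation D) {M N : Subgroup G} [M.Normal] [N.Normal]
    (hle : M ≤ N) (h : D (G ⧸ M)) : D (G ⧸ N) := by
  refine hD.of_surjective (QuotientGroup.map M N (MonoidHom.id G) hle) ?_ h
  exact QuotientGroup.map_surjective_of_surjective _ _ _
    ((QuotientGroup.mk'_surjective _).comp Function.surjective_id) _

theorem extensionClass_iff (hC : IsFittingFormation C) (hD : IsFittingFormation D) :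
    ExtensionClass C D G ↔ D (G ⧸ radical C G) := by
  refine ⟨?_, fun h => ⟨radical C G, inferInstance, hC.radical_mem, h⟩⟩
  rintro ⟨N, hN, h1, h2⟩
  exact hD.quotient_of_le (le_sSup ⟨hN, h1⟩) h2

/-- The radical of the subnormal `M` is subnormal in `G`, so it lies in the radical of `G`; the
image of `M` is therefore a quotient of `M ⧸ radical C M`. -/
theorem of_quotient_subgroupOf_radical (hC : IsFittingFormation C) (hD : IsFittingFormation D)
    (M : Subgroup G) (hM : M.IsSubnormal) (h : ExtensionClass C D M) :
    D (M.map (QuotientGroup.mk' (radical C G))) := by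
  rw [hC.extensionClass_iff hD] at h
  let f := (QuotientGroup.mk' (radical C G)).subgroupMap M
  have hf : radical C M ≤ f.ker := by
    intro x hx
    have h1 : (radical C M).map M.subtype ≤ radical C G :=
      hC.le_radical_of_isSubnormal
        (Subgroup.IsSubnormal.trans' (radical_normal C M).isSubnormal hM)
        (hC.map _ _ hC.radical_mem)
    have h2 : (x : G) ∈ radical C G := h1 ⟨x, hx, rfl⟩
    rw [MonoidHom.mem_ker, Subtype.ext_iff]
    exact (QuotientGroup.eq_one_iff _).2 h2
  refine hD.of_surjective (QuotientGroup.lift (radical C M) f hf) ?_ h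
  exact QuotientGroup.lift_surjective_of_surjective _ _
    ((QuotientGroup.mk' (radical C G)).subgroupMap_surjective M) _

/-- For a normal subgroup `M`, the quotient $M/(M\cap N)$ embeds as the normal subgroup $MN/N$ of
$G/N$. For products, different factors may come with unrelated normal `C`-subgroups; replacing all
of these by the radical of `G` makes the images of both factors normal `D`-subgroups of one
quotient. -/
theorem extensionClass (hC : IsFittingFormation C) (hD : IsFittingFormation D) :
    IsFittingFormation (ExtensionClass C D) where
  of_subsingleton G _ _ := ⟨⊥, inferInstance, hC.of_subsingleton _,
    haveI : Subsingleton (G ⧸ (⊥ : Subgroup G)) :=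
      (QuotientGroup.mk'_surjective _).subsingleton
    hD.of_subsingleton _⟩
  of_surjective := by
    rintro G H _ _ _ f hf ⟨N, hN, h1, h2⟩
    have hn : (N.map f).Normal := hN.map f hf
    refine ⟨N.map f, hn, hC.map f N h1, ?_⟩
    refine hD.of_surjective (QuotientGroup.map N (N.map f) f (Subgroup.le_comap_map f N)) ?_ h2
    exact QuotientGroup.map_surjective_of_surjective _ _ _
      ((QuotientGroup.mk'_surjective _).comp hf) _
  of_normal := by
    rintro G _ _ M hM ⟨N, hN, h1, h2⟩
    refine ⟨N.subgroupOf M, inferInstance, ?_, ?_⟩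
    · refine hC.of_injective
        ((M.subtype.comp (N.subgroupOf M).subtype).codRestrict N fun x => x.2) ?_ ?_ h1
      · intro x y hxy
        exact Subtype.ext (Subtype.ext (congrArg (Subtype.val : N → G) hxy))
      · have : MonoidHom.range ((M.subtype.comp (N.subgroupOf M).subtype).codRestrict N
            fun x => x.2) = M.subgroupOf N := by
          ext x
          constructor
          · rintro ⟨y, rfl⟩
            exact y.1.2
          · intro hx
            exact ⟨⟨⟨x, hx⟩, x.2⟩, rfl⟩
        rw [this]
        infer_instance
    · refine hD.of_injective (QuotientGroup.map (N.subgroupOf M) N M.subtype le_rfl) ?_ ?_ h2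
      · rw [injective_iff_map_eq_one]
        intro x
        induction x using QuotientGroup.induction_on with
        | H x =>
          intro hx
          exact (QuotientGroup.eq_one_iff x).2 ((QuotientGroup.eq_one_iff (x : G)).1 hx)
      · have : MonoidHom.range (QuotientGroup.map (N.subgroupOf M) N M.subtype le_rfl) =
            M.map (QuotientGroup.mk' N) := by
          ext x
          constructor
          · rintro ⟨y, rfl⟩
            induction y using QuotientGroup.induction_on with
            | H y => exact ⟨y, y.2, rfl⟩
          · rintro ⟨y, hy, rfl⟩
            exact ⟨QuotientGroup.mk ⟨y, hy⟩, rfl⟩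
        rw [this]
        exact hM.map _ (QuotientGroup.mk'_surjective _)
  of_sup_eq_top := by
    intro G _ _ M N hM hN h1 h2 h
    rw [hC.extensionClass_iff hD]
    have := hM.map _ (QuotientGroup.mk'_surjective (radical C G))
    have := hN.map _ (QuotientGroup.mk'_surjective (radical C G))
    refine hD.of_sup_eq_top _ _ (hC.of_quotient_subgroupOf_radical hD M hM.isSubnormal h1)
      (hC.of_quotient_subgroupOf_radical hD N hN.isSubnormal h2) ?_
    rw [← Subgroup.map_sup, h, Subgroup.map_top_of_surjective _ (QuotientGroup.mk'_surjective _)]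

theorem extensionClass_of_subgroupOf (hC : IsFittingFormation C) {N M : Subgroup G} [N.Normal]
    (hle : N ≤ M) (hN : C N) (hD : D (M ⧸ N.subgroupOf M)) : ExtensionClass C D M :=
  ⟨N.subgroupOf M, inferInstance, hC.of_mulEquiv (Subgroup.subgroupOfEquivOfLe hle).symm hN, hD⟩

theorem radical_extensionClass (hC : IsFittingFormation C) (hD : IsFittingFormation D) :
    radical (ExtensionClass C D) G =
      (radical D (G ⧸ radical C G)).comap (QuotientGroup.mk' (radical C G)) := by
  apply le_antisymm
  · refine sSup_le fun N hN => ?_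
    rw [← Subgroup.map_le_iff_le_comap]
    exact le_sSup ⟨hN.1.map _ (QuotientGroup.mk'_surjective _),
      hC.of_quotient_subgroupOf_radical hD N hN.1.isSubnormal hN.2⟩
  · set R := radical C G
    set P := (radical D (G ⧸ R)).comap (QuotientGroup.mk' R) with hP
    have hle : R ≤ P := fun x hx => by
      have h1 : QuotientGroup.mk' R x = 1 := (QuotientGroup.eq_one_iff x).2 hx
      rw [hP, Subgroup.mem_comap, h1]
      exact one_mem _
    refine le_sSup ⟨inferInstance, hC.extensionClass_of_subgroupOf hle hC.radical_mem ?_⟩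
    exact hD.of_mulEquiv (comapQuotientEquiv R _).symm hD.radical_mem

end IsFittingFormation

/-! ### Nilpotent and soluble groups -/

/-- Take the least term of the upper central series meeting `A` nontrivially; commutators of this
intersection with the group fall into the preceding, trivial, intersection. -/
theorem inf_center_ne_bot_of_isNilpotent {G : Type u} [Group G] [Group.IsNilpotent G]
    (A : Subgroup G) [hA : A.Normal] (hne : A ≠ ⊥) : A ⊓ Subgroup.center G ≠ ⊥ := by
  classical
  obtain ⟨c, hc⟩ := Group.IsNilpotent.nilpotent G
  have hex : ∃ i, A ⊓ Subgroup.upperCentralSeries G i ≠ ⊥ := ⟨c, by rwa [hc, inf_top_eq]⟩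
  have hspec := Nat.find_spec hex
  cases hi : Nat.find hex with
  | zero => rw [hi] at hspec; simp at hspec
  | succ i =>
    rw [hi] at hspec
    have hmin : A ⊓ Subgroup.upperCentralSeries G i = ⊥ := by
      by_contra h
      exact Nat.find_min hex (m := i) (by omega) h
    obtain ⟨⟨x, hx⟩, hx1⟩ := Subgroup.ne_bot_iff_exists_ne_one.1 hspec
    intro hbot
    apply hx1
    have : x ∈ A ⊓ Subgroup.center G := by
      refine ⟨hx.1, Subgroup.mem_center_iff.2 fun g => ?_⟩
      have h1 : x * g * x⁻¹ * g⁻¹ ∈ A ⊓ Subgroup.upperCentralSeries G i := by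
        refine ⟨?_, Subgroup.mem_upperCentralSeries_succ_iff.1 hx.2 g⟩
        have := A.mul_mem hx.1 (hA.conj_mem _ (A.inv_mem hx.1) g)
        simpa [mul_assoc] using this
      rw [hmin, Subgroup.mem_bot, mul_inv_eq_one, mul_inv_eq_iff_eq_mul] at h1
      exact h1.symm
    rw [hbot, Subgroup.mem_bot] at this
    exact Subtype.ext this

/-- Let $Z=Z(M)$, which is normal in `G`. If $Z\cap N=1$, then $Z$ centralizes `N` as well as `M`;
otherwise $Z\cap N$ meets $Z(N)$, and the intersection centralizes both factors. -/
theorem center_ne_bot_of_sup_eq_top {G : Type u} [Group G] [Nontrivial G] (M N : Subgroup G)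
    [M.Normal] [N.Normal] [Group.IsNilpotent M] [Group.IsNilpotent N] (h : M ⊔ N = ⊤) :
    Subgroup.center G ≠ ⊥ := by
  have key : ∀ x : G, x ∈ Subgroup.centralizer (M : Set G) →
      x ∈ Subgroup.centralizer (N : Set G) → x ∈ Subgroup.center G := by
    intro x hM hN
    have h1 : M ⊔ N ≤ Subgroup.centralizer {x} := by
      refine sup_le (fun m hm => ?_) (fun m hm => ?_)
      · rw [Subgroup.mem_centralizer_singleton_iff]; exact hM m hm
      · rw [Subgroup.mem_centralizer_singleton_iff]; exact hN m hm
    rw [h] at h1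
    exact Subgroup.mem_center_iff.2 fun g =>
      Subgroup.mem_centralizer_singleton_iff.1 (h1 (Subgroup.mem_top g))
  rcases eq_or_ne M ⊥ with rfl | hM
  · rw [bot_sup_eq] at h
    subst h
    have : Group.IsNilpotent G := Group.isNilpotent_top.1 inferInstance
    exact Group.IsNilpotent.center_ne_bot _
  · have : Nontrivial M := (Subgroup.nontrivial_iff_ne_bot M).2 hM
    set Z : Subgroup G := (Subgroup.center M).map M.subtype with hZ
    have hZn : Z.Normal := ConjAct.normal_of_characteristic_of_normal
    have hZ1 : Z ≠ ⊥ := by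
      rw [hZ, Ne, Subgroup.map_eq_bot_iff_of_injective _ M.subtype_injective]
      exact Group.IsNilpotent.center_ne_bot _
    have hZM : Z ≤ Subgroup.centralizer (M : Set G) := by
      rintro _ ⟨z, hz, rfl⟩ m hm
      exact congrArg Subtype.val (Subgroup.mem_center_iff.1 hz ⟨m, hm⟩)
    by_cases hd : Z ⊓ N = ⊥
    · refine fun hbot => hZ1 (le_bot_iff.1 (hbot ▸ fun z hz => key z (hZM hz) fun n hn => ?_))
      exact (Subgroup.commute_of_normal_of_disjoint Z N hZn inferInstance
        (disjoint_iff.2 hd) z n hz hn).symm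
    · have h1 : Z.subgroupOf N ≠ ⊥ := by
        rwa [Ne, Subgroup.subgroupOf_eq_bot, disjoint_iff]
      have h2 := inf_center_ne_bot_of_isNilpotent (Z.subgroupOf N) h1
      obtain ⟨x, hx⟩ := Subgroup.ne_bot_iff_exists_ne_one.1 h2
      intro hbot
      have h3 : ((x : N) : G) ∈ Subgroup.center G := by
        refine key _ (hZM x.2.1) fun n hn => ?_
        exact congrArg Subtype.val (Subgroup.mem_center_iff.1 x.2.2 ⟨n, hn⟩)
      rw [hbot, Subgroup.mem_bot] at h3
      exact hx (Subtype.ext (Subtype.ext h3))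

/-- The product of two nilpotent normal subgroups of a finite group is nilpotent. -/
theorem isNilpotent_of_sup_eq_top {G : Type u} [Group G] [Finite G] (M N : Subgroup G)
    [hMn : M.Normal] [hNn : N.Normal] [hM : Group.IsNilpotent M] [hN : Group.IsNilpotent N]
    (h : M ⊔ N = ⊤) : Group.IsNilpotent G := by
  induction hc : Nat.card G using Nat.strong_induction_on generalizing G with
  | _ c ih =>
    rcases subsingleton_or_nontrivial G with hs | hs
    · exact Group.isNilpotent_of_subsingleton
    · have hZ := center_ne_bot_of_sup_eq_top M N h
      apply Group.of_quotient_center_nilpotent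
      let f := QuotientGroup.mk' (Subgroup.center G)
      have hf : Function.Surjective f := QuotientGroup.mk'_surjective _
      have := hMn.map f hf
      have := hNn.map f hf
      have := Group.nilpotent_of_surjective (f.subgroupMap M) (f.subgroupMap_surjective M)
      have := Group.nilpotent_of_surjective (f.subgroupMap N) (f.subgroupMap_surjective N)
      refine ih (Nat.card (G ⧸ Subgroup.center G)) ?_ (M.map f) (N.map f) ?_ rfl
      · rw [← hc, ← Subgroup.index_eq_card, ← Subgroup.index_mul_card (Subgroup.center G)]
        have h1 := (Subgroup.one_lt_card_iff_ne_bot _).2 hZ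
        have h2 : 0 < (Subgroup.center G).index :=
          Nat.pos_of_ne_zero Subgroup.index_ne_zero_of_finite
        nlinarith
      · rw [← Subgroup.map_sup, h, Subgroup.map_top_of_surjective _ hf]

theorem isFittingFormation_isNilpotent :
    IsFittingFormation.{u} (fun G _ => Group.IsNilpotent G) where
  of_subsingleton _ _ _ := inferInstance
  of_surjective f hf _ := Group.nilpotent_of_surjective f hf
  of_normal _ _ _ := inferInstance
  of_sup_eq_top M N _ _ _ _ h := isNilpotent_of_sup_eq_top M N h

theorem isFittingFormation_isSolvable :
    IsFittingFormation.{u} (fun G _ => Group.IsSolvable G) where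
  of_subsingleton _ _ _ := inferInstance
  of_surjective _ hf _ := Group.isSolvable_of_surjective hf
  of_normal _ _ _ := inferInstance
  of_sup_eq_top M N _ _ hM hN h := by
    refine (Group.isSolvable_iff_subgroup_quotient M).2 ⟨hM, ?_⟩
    refine Group.isSolvable_of_surjective (f := (QuotientGroup.mk' M).comp N.subtype) ?_
    intro x
    obtain ⟨x, rfl⟩ := QuotientGroup.mk'_surjective M x
    obtain ⟨m, hm, n, hn, rfl⟩ := Subgroup.mem_sup_of_normal_left.1
      (h.ge (Subgroup.mem_top x) : x ∈ M ⊔ N)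
    refine ⟨⟨n, hn⟩, ?_⟩
    have h1 : QuotientGroup.mk' M m = 1 := (QuotientGroup.eq_one_iff m).2 hm
    rw [map_mul, h1, one_mul]
    rfl

instance fitting_normal (G : Type u) [Group G] : (fitting G).Normal :=
  radical_normal _ G

theorem isNilpotent_fitting (G : Type u) [Group G] [Finite G] : Group.IsNilpotent (fitting G) :=
  isFittingFormation_isNilpotent.radical_mem

theorem le_fitting_of_isSubnormal {G : Type u} [Group G] [Finite G] {K : Subgroup G}
    (hK : K.IsSubnormal) (h : Group.IsNilpotent K) : K ≤ fitting G :=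
  isFittingFormation_isNilpotent.le_radical_of_isSubnormal hK h

/-! ### Quasisimple groups and components -/

theorem IsNonabelianSimple.not_isSolvable {G : Type u} [Group G] (h : IsNonabelianSimple G) :
    ¬ Group.IsSolvable G := by
  obtain ⟨hs, a, b, hab⟩ := h
  exact fun h => hab (IsSimpleGroup.comm_iff_isSolvable.2 h a b)

theorem IsNonabelianSimple.center_eq_bot {G : Type u} [Group G] (h : IsNonabelianSimple G) :
    Subgroup.center G = ⊥ := by
  obtain ⟨hs, a, b, hab⟩ := h
  refine (Subgroup.Normal.eq_bot_or_eq_top inferInstance).resolve_right fun ht => hab ?_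
  exact Subgroup.mem_center_iff.1 (ht.ge (Subgroup.mem_top b)) a

theorem IsNonabelianSimple.commutator_eq_top {G : Type u} [Group G] (h : IsNonabelianSimple G) :
    commutator G = ⊤ := by
  have hs := h.1
  refine (Subgroup.Normal.eq_bot_or_eq_top inferInstance).resolve_left fun hb => ?_
  obtain ⟨-, a, b, hab⟩ := h
  have : ⁅a, b⁆ ∈ commutator G :=
    Subgroup.commutator_mem_commutator (Subgroup.mem_top a) (Subgroup.mem_top b)
  rw [hb, Subgroup.mem_bot] at this
  exact hab (commutatorElement_eq_one_iff_mul_comm.1 this)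

theorem IsNonabelianSimple.isQuasisimple {G : Type u} [Group G] (h : IsNonabelianSimple G) :
    IsQuasisimple G := by
  refine ⟨h.commutator_eq_top, ?_⟩
  exact h.of_equiv ((QuotientGroup.quotientMulEquivOfEq h.center_eq_bot).trans
    QuotientGroup.quotientBot).symm

theorem IsQuasisimple.not_isSolvable {Q : Type u} [Group Q] (h : IsQuasisimple Q) :
    ¬ Group.IsSolvable Q := by
  intro _
  exact h.2.not_isSolvable inferInstance

/-- By simplicity of $Q/Z(Q)$, the alternative is $Q=NZ(Q)$, and then $Q=[Q,Q]=[NZ(Q),Q]=[N,Q]\le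
N$. -/
theorem IsQuasisimple.le_center_of_normal {Q : Type u} [Group Q] (h : IsQuasisimple Q)
    (N : Subgroup Q) [hN : N.Normal] (hne : N ≠ ⊤) : N ≤ Subgroup.center Q := by
  have hs := h.2.1
  have hn := hN.map _ (QuotientGroup.mk'_surjective (Subgroup.center Q))
  rcases hn.eq_bot_or_eq_top with hb | ht
  · rwa [Subgroup.map_eq_bot_iff, QuotientGroup.ker_mk'] at hb
  · exfalso
    apply hne
    have h1 : N ⊔ Subgroup.center Q = ⊤ := by
      have := congrArg (Subgroup.comap (QuotientGroup.mk' (Subgroup.center Q))) ht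
      rwa [Subgroup.comap_map_eq, QuotientGroup.ker_mk', Subgroup.comap_top] at this
    rw [← top_le_iff, ← h.1]
    refine Subgroup.commutator_le.2 fun a _ b _ => ?_
    obtain ⟨n, hn, z, hz, rfl⟩ := Subgroup.mem_sup_of_normal_left.1
      (h1.ge (Subgroup.mem_top a) : a ∈ N ⊔ Subgroup.center Q)
    have h2 : ⁅n * z, b⁆ = ⁅n, b⁆ := by
      have := Subgroup.mem_center_iff.1 hz
      rw [commutatorElement_def, commutatorElement_def]
      have h3 : z * b * z⁻¹ = b := by rw [← this b]; group
      calc n * z * b * (n * z)⁻¹ * b⁻¹ = n * (z * b * z⁻¹) * n⁻¹ * b⁻¹ := by group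
        _ = _ := by rw [h3]
    rw [h2, commutatorElement_def, mul_assoc, mul_assoc]
    refine N.mul_mem hn ?_
    rw [← mul_assoc]
    exact hN.conj_mem _ (N.inv_mem hn) b

/-- A nontrivial perfect group is not abelian, so the preimage of $Z(H)$ is a proper normal subgroup
and hence central; thus `Q` and `H` have the same central quotient. -/
theorem IsQuasisimple.of_surjective {Q H : Type u} [Group Q] [Group H] (h : IsQuasisimple Q)
    (f : Q →* H) (hf : Function.Surjective f) [Nontrivial H] : IsQuasisimple H := by
  have hcomm : commutator H = ⊤ := by
    have h1 := Subgroup.map_commutator (⊤ : Subgroup Q) ⊤ f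
    have h3 : ⁅(⊤ : Subgroup Q), ⊤⁆ = ⊤ := h.1
    rw [h3, Subgroup.map_top_of_surjective _ hf] at h1
    exact h1.symm
  have hpre : (Subgroup.center H).comap f = Subgroup.center Q := by
    apply le_antisymm
    · refine h.le_center_of_normal _ fun ht => ?_
      have h1 : Subgroup.center H = ⊤ := by
        have := congrArg (Subgroup.map f) ht
        rwa [Subgroup.map_comap_eq_self_of_surjective hf,
          Subgroup.map_top_of_surjective _ hf] at this
      have h2 : commutator H = ⊥ := by
        rw [commutator_def, Subgroup.commutator_eq_bot_iff_le_centralizer]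
        simp [Subgroup.centralizer_univ, h1]
      rw [hcomm] at h2
      exact top_ne_bot h2
    · intro z hz
      refine Subgroup.mem_center_iff.2 fun y => ?_
      obtain ⟨x, rfl⟩ := hf y
      rw [← map_mul, ← map_mul, Subgroup.mem_center_iff.1 hz x]
  refine ⟨hcomm, ?_⟩
  let g : Q →* H ⧸ Subgroup.center H := (QuotientGroup.mk' _).comp f
  have hg : Function.Surjective g := (QuotientGroup.mk'_surjective _).comp hf
  have hker : Subgroup.center Q = g.ker := by
    rw [← hpre, ← MonoidHom.comap_ker, QuotientGroup.ker_mk']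
  exact h.2.of_equiv ((QuotientGroup.quotientMulEquivOfEq hker).trans
    (QuotientGroup.quotientKerEquivOfSurjective g hg))

/-- This is the three subgroups lemma with $Q=[Q,Q]$. -/
theorem commutator_eq_bot_of_perfect {G : Type u} [Group G] {A Q : Subgroup G}
    (hQ : ⁅Q, Q⁆ = Q) (h : ⁅⁅A, Q⁆, Q⁆ = ⊥) : ⁅A, Q⁆ = ⊥ := by
  have := Subgroup.commutator_commutator_eq_bot_of_rotate (H₁ := Q) (H₂ := Q) (H₃ := A)
    (by rwa [Subgroup.commutator_comm Q A]) h
  rwa [hQ, Subgroup.commutator_comm] at this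

theorem exists_iterate_commutator_le_of_isSubnormal {G : Type u} [Group G] (N : Subgroup G)
    {K : Subgroup G} (hK : K.IsSubnormal) {Q : Subgroup G} (hQ : Q ≤ K) :
    ∃ j : ℕ, (fun A : Subgroup G => ⁅A, Q⁆)^[j] N ≤ K := by
  induction hK with
  | top => exact ⟨0, le_top⟩
  | step K L hle _ hn ih =>
    obtain ⟨j, hj⟩ := ih (hQ.trans hle)
    refine ⟨j + 1, ?_⟩
    rw [Function.iterate_succ_apply']
    refine (Subgroup.commutator_mono hj hQ).trans ?_
    have h1 := (Subgroup.normal_subgroupOf_iff_le_normalizer hle).1 hn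
    refine Subgroup.commutator_le.2 fun a ha b hb => ?_
    rw [commutatorElement_def]
    exact K.mul_mem ((Subgroup.mem_normalizer_iff.1 (h1 ha) b).1 hb) (K.inv_mem hb)

theorem IsQuasisimple.commutator_self {G : Type u} [Group G] {Q : Subgroup G}
    (hQ : IsQuasisimple Q) : ⁅Q, Q⁆ = Q := by
  have h1 := Subgroup.map_commutator (⊤ : Subgroup Q) ⊤ Q.subtype
  have h3 : ⁅(⊤ : Subgroup Q), ⊤⁆ = ⊤ := hQ.1
  rw [h3, ← MonoidHom.range_eq_map, Subgroup.range_subtype] at h1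
  exact h1.symm

/-- By subnormality $[N,Q,\dots,Q]\le Q\cap N$, which is central in `Q` unless $Q\le N$. So one
further commutator is trivial, and the three subgroups lemma then removes the repetitions of `Q` one
at a time. -/
theorem IsQuasisimple.le_or_commutator_eq_bot_of_normal {G : Type u} [Group G] {Q : Subgroup G}
    (hQ : IsQuasisimple Q) (hQs : Q.IsSubnormal) (N : Subgroup G) [hN : N.Normal] :
    Q ≤ N ∨ ⁅N, Q⁆ = ⊥ := by
  rw [or_iff_not_imp_left]
  intro hle
  have hcent : ⁅Q ⊓ N, Q⁆ = ⊥ := by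
    have h1 : N.subgroupOf Q ≤ Subgroup.center Q :=
      hQ.le_center_of_normal _ fun h => hle (Subgroup.subgroupOf_eq_top.1 h)
    rw [Subgroup.commutator_eq_bot_iff_le_centralizer]
    intro x hx y hy
    exact congrArg Subtype.val (Subgroup.mem_center_iff.1 (h1 (x := ⟨x, hx.1⟩) hx.2) ⟨y, hy⟩)
  obtain ⟨j, hj⟩ := exists_iterate_commutator_le_of_isSubnormal N hQs le_rfl
  have hjN : ∀ i, (fun A : Subgroup G => ⁅A, Q⁆)^[i] N ≤ N := by
    intro i
    induction i with
    | zero => exact le_rfl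
    | succ i ih =>
      rw [Function.iterate_succ_apply']
      exact (Subgroup.commutator_mono ih le_rfl).trans (Subgroup.commutator_le_left N Q)
  have hbot : ⁅(fun A : Subgroup G => ⁅A, Q⁆)^[j] N, Q⁆ = ⊥ :=
    le_bot_iff.1 (hcent ▸ Subgroup.commutator_mono (le_inf hj (hjN j)) le_rfl)
  clear hj
  induction j with
  | zero => exact hbot
  | succ j ih =>
    rw [Function.iterate_succ_apply'] at hbot
    exact ih (commutator_eq_bot_of_perfect hQ.commutator_self hbot)

/-- A subnormal quasisimple subgroup is contained in a given subnormal subgroup or centralizes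
it. -/
theorem IsQuasisimple.le_or_commutator_eq_bot {G : Type u} [Group G] {Q N : Subgroup G}
    (hQ : IsQuasisimple Q) (hQs : Q.IsSubnormal) (hN : N.IsSubnormal) :
    Q ≤ N ∨ ⁅N, Q⁆ = ⊥ := by
  induction hN with
  | top => exact Or.inl le_top
  | step N L hle _ hn ih =>
    rcases ih with h | h
    · have hQ' : IsQuasisimple (Q.subgroupOf L) :=
        hQ.of_equiv (Subgroup.subgroupOfEquivOfLe h).symm
      rcases hQ'.le_or_commutator_eq_bot_of_normal hQs.subgroupOf (N.subgroupOf L) with h1 | h1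
      · left
        have := Subgroup.map_mono (f := L.subtype) h1
        rwa [Subgroup.map_subgroupOf_eq_of_le h, Subgroup.map_subgroupOf_eq_of_le hle] at this
      · right
        have := Subgroup.map_commutator (N.subgroupOf L) (Q.subgroupOf L) L.subtype
        rw [h1, Subgroup.map_bot, Subgroup.map_subgroupOf_eq_of_le h,
          Subgroup.map_subgroupOf_eq_of_le hle] at this
        exact this.symm
    · exact Or.inr (le_bot_iff.1 (h ▸ Subgroup.commutator_mono hle le_rfl))

theorem IsQuasisimple.eq_or_commutator_eq_bot {G : Type u} [Group G] {P Q : Subgroup G}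
    (hP : IsQuasisimple P) (hPs : P.IsSubnormal) (hQ : IsQuasisimple Q) (hQs : Q.IsSubnormal) :
    P = Q ∨ ⁅P, Q⁆ = ⊥ := by
  rcases hP.le_or_commutator_eq_bot hPs hQs with h | h
  · rcases hQ.le_or_commutator_eq_bot hQs hPs with h' | h'
    · exact Or.inl (le_antisymm h h')
    · exact Or.inr h'
  · exact Or.inr (by rwa [Subgroup.commutator_comm])

theorem IsQuasisimple.commutator_fitting_eq_bot {G : Type u} [Group G] [Finite G]
    {Q : Subgroup G} (hQ : IsQuasisimple Q) (hQs : Q.IsSubnormal) : ⁅fitting G, Q⁆ = ⊥ := by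
  refine (hQ.le_or_commutator_eq_bot_of_normal hQs (fitting G)).resolve_left fun h => ?_
  have := isNilpotent_fitting G
  exact hQ.not_isSolvable
    (Group.isSolvable_of_isSolvable_injective (Subgroup.inclusion_injective h))

/-! ### Quasinilpotent groups and the generalized Fitting subgroup -/

/-- A group is quasinilpotent if it coincides with its generalized Fitting subgroup. -/
def IsQuasinilpotent (G : Type u) [Group G] : Prop :=
  genFitting G = ⊤

instance instNormalGenFitting (G : Type u) [Group G] : (genFitting G).Normal := genFitting_normal G

theorem isNilpotent_of_mul_comm {G : Type u} [Group G] (h : ∀ a b : G, a * b = b * a) :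
    Group.IsNilpotent G :=
  letI : CommGroup G := { (inferInstance : Group G) with mul_comm := h }
  CommGroup.isNilpotent

theorem le_genFitting_of_isNilpotent {G : Type u} [Group G] [Finite G] {K : Subgroup G}
    (hK : K.IsSubnormal) (h : Group.IsNilpotent K) : K ≤ genFitting G :=
  (le_fitting_of_isSubnormal hK h).trans le_sup_left

theorem le_genFitting_of_isQuasisimple {G : Type u} [Group G] {K : Subgroup G}
    (hK : K.IsSubnormal) (h : IsQuasisimple K) : K ≤ genFitting G :=
  (le_sSup ⟨hK, h⟩ : K ≤ sSup {Q : Subgroup G | Q.IsSubnormal ∧ IsQuasisimple Q}).trans le_sup_right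

theorem le_map_genFitting_of_isNilpotent {G : Type u} [Group G] [Finite G] {K N : Subgroup G}
    (hK : K.IsSubnormal) (h : Group.IsNilpotent K) (hle : K ≤ N) :
    K ≤ (genFitting N).map N.subtype := by
  have h1 := le_genFitting_of_isNilpotent (hK.subgroupOf (K := N))
    (Group.nilpotent_of_mulEquiv (Subgroup.subgroupOfEquivOfLe hle).symm)
  have h2 := Subgroup.map_mono (f := N.subtype) h1
  rwa [Subgroup.map_subgroupOf_eq_of_le hle] at h2

theorem le_map_genFitting_of_isQuasisimple {G : Type u} [Group G] {K N : Subgroup G}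
    (hK : K.IsSubnormal) (h : IsQuasisimple K) (hle : K ≤ N) :
    K ≤ (genFitting N).map N.subtype := by
  have h1 := le_genFitting_of_isQuasisimple (hK.subgroupOf (K := N))
    (h.of_equiv (Subgroup.subgroupOfEquivOfLe hle).symm)
  have h2 := Subgroup.map_mono (f := N.subtype) h1
  rwa [Subgroup.map_subgroupOf_eq_of_le hle] at h2

theorem isQuasinilpotent_of_le_map_genFitting {G : Type u} [Group G] {N : Subgroup G}
    (h : N ≤ (genFitting N).map N.subtype) : IsQuasinilpotent N := by
  refine top_le_iff.1 fun x _ => ?_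
  obtain ⟨y, hy, hyx⟩ := h x.2
  rwa [← Subtype.ext hyx]

theorem map_genFitting_subtype_le {G : Type u} [Group G] [Finite G] {K : Subgroup G}
    (hK : K.IsSubnormal) : (genFitting K).map K.subtype ≤ genFitting G := by
  rw [Subgroup.map_le_iff_le_comap]
  refine sup_le ?_ (sSup_le fun Q hQ => ?_)
  · rw [← Subgroup.map_le_iff_le_comap]
    refine le_genFitting_of_isNilpotent
      (Subgroup.IsSubnormal.trans' (fitting_normal K).isSubnormal hK) ?_
    exact isFittingFormation_isNilpotent.map K.subtype _ (isNilpotent_fitting K)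
  · rw [← Subgroup.map_le_iff_le_comap]
    exact le_genFitting_of_isQuasisimple (hQ.1.trans' hK)
      (hQ.2.of_equiv (Q.equivMapOfInjective _ K.subtype_injective))

theorem map_genFitting_le {G H : Type u} [Group G] [Group H] [Finite G] (f : G →* H)
    (hf : Function.Surjective f) : (genFitting G).map f ≤ genFitting H := by
  rw [Subgroup.map_le_iff_le_comap]
  refine sup_le ?_ (sSup_le fun Q hQ => ?_)
  · rw [← Subgroup.map_le_iff_le_comap]
    exact (isFittingFormation_isNilpotent.map_radical_le f hf).trans le_sup_left
  · rw [← Subgroup.map_le_iff_le_comap]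
    rcases subsingleton_or_nontrivial (Q.map f) with h | h
    · rw [(Subgroup.eq_bot_iff_forall _).2 fun x hx =>
        congrArg Subtype.val (Subsingleton.elim (⟨x, hx⟩ : Q.map f) 1)]
      exact bot_le
    · exact le_genFitting_of_isQuasisimple (hQ.1.map hf)
        (hQ.2.of_surjective (f.subgroupMap Q) (f.subgroupMap_surjective Q))

/-- Split the quasisimple subnormal subgroups into those inside `N`, generating `C`, and the rest,
generating `D`. Then `D` centralizes both `F` and `N`, so the `D`-part of an element of `N` is
central in `D`, hence lies in `F`. -/
theorem IsQuasinilpotent.of_normal {G : Type u} [Group G] [Finite G] (hG : IsQuasinilpotent G)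
    (N : Subgroup G) [hN : N.Normal] : IsQuasinilpotent N := by
  apply isQuasinilpotent_of_le_map_genFitting
  let F := fitting G
  let C := sSup {Q : Subgroup G | (Q.IsSubnormal ∧ IsQuasisimple Q) ∧ Q ≤ N}
  let D := sSup {Q : Subgroup G | (Q.IsSubnormal ∧ IsQuasisimple Q) ∧ ¬ Q ≤ N}
  have hconj : ∀ (Q : Subgroup G) (g : G),
      Q.map (MulAut.conj g).toMonoidHom ≤ N ↔ Q ≤ N := by
    intro Q g
    rw [Subgroup.map_le_iff_le_comap]
    have : N.comap (MulAut.conj g).toMonoidHom = N := by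
      ext x
      exact (hN.mem_comm_iff.trans (by simp) : g * x * g⁻¹ ∈ N ↔ x ∈ N)
    rw [this]
  have hsub : ∀ Q : Subgroup G, Q.IsSubnormal ∧ IsQuasisimple Q → ∀ g : G,
      (Q.map (MulAut.conj g).toMonoidHom).IsSubnormal ∧
        IsQuasisimple (Q.map (MulAut.conj g).toMonoidHom) := fun Q hQ g =>
    ⟨hQ.1.map (MulAut.conj g).surjective,
      hQ.2.of_equiv (Q.equivMapOfInjective _ (MulAut.conj g).injective)⟩
  have hCn : C.Normal := sSup_normal_of_conj _ fun Q hQ g =>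
    ⟨hsub Q hQ.1 g, (hconj Q g).2 hQ.2⟩
  have hDn : D.Normal := sSup_normal_of_conj _ fun Q hQ g =>
    ⟨hsub Q hQ.1 g, fun h => hQ.2 ((hconj Q g).1 h)⟩
  have hDF : D ≤ Subgroup.centralizer (F : Set G) := sSup_le fun Q hQ => by
    rw [← Subgroup.commutator_eq_bot_iff_le_centralizer, Subgroup.commutator_comm]
    exact hQ.1.2.commutator_fitting_eq_bot hQ.1.1
  have hDN : D ≤ Subgroup.centralizer (N : Set G) := sSup_le fun Q hQ => by
    rw [← Subgroup.commutator_eq_bot_iff_le_centralizer, Subgroup.commutator_comm]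
    exact (hQ.1.2.le_or_commutator_eq_bot_of_normal hQ.1.1 N).resolve_left hQ.2
  have hZF : D ⊓ Subgroup.centralizer (D : Set G) ≤ F := by
    refine le_fitting_of_isSubnormal (Subgroup.Normal.isSubnormal inferInstance) ?_
    exact isNilpotent_of_mul_comm fun a b => Subtype.ext (b.2.2 a a.2.1)
  have htop : C ⊔ (F ⊔ D) = ⊤ := by
    rw [← top_le_iff, ← (show genFitting G = ⊤ from hG)]
    refine sup_le (le_sup_left.trans le_sup_right) (sSup_le fun Q hQ => ?_)
    by_cases h : Q ≤ N
    · exact (le_sSup ⟨hQ, h⟩ : Q ≤ C).trans le_sup_left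
    · exact (le_sSup ⟨hQ, h⟩ : Q ≤ D).trans (le_sup_right.trans le_sup_right)
  have hCN : C ≤ N := sSup_le fun Q hQ => hQ.2
  have hCT : C ≤ (genFitting N).map N.subtype := sSup_le fun Q hQ =>
    le_map_genFitting_of_isQuasisimple hQ.1.1 hQ.1.2 hQ.2
  have hFT : F ⊓ N ≤ (genFitting N).map N.subtype := by
    have hFn : F.Normal := fitting_normal G
    refine le_map_genFitting_of_isNilpotent (Subgroup.Normal.isSubnormal inferInstance) ?_
      inf_le_right
    have := isNilpotent_fitting G
    exact Group.nilpotent_of_mulEquiv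
      (Subgroup.subgroupOfEquivOfLe (inf_le_left : F ⊓ N ≤ F))
  intro x hx
  obtain ⟨c, hc, y, hy, rfl⟩ := Subgroup.mem_sup_of_normal_left.1
    (htop.ge (Subgroup.mem_top x) : x ∈ C ⊔ (F ⊔ D))
  obtain ⟨f, hf, d, hd, rfl⟩ := Subgroup.mem_sup_of_normal_right.1 hy
  have hfd : f * d ∈ N := (N.mul_mem_cancel_left (hCN hc)).1 hx
  -- Elements of `D` commute with `f * d`, which lies in `N`, and with `f`; hence they commute with
  -- `d`.
  have hdZ : d ∈ D ⊓ Subgroup.centralizer (D : Set G) := by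
    refine ⟨hd, fun y hy => ?_⟩
    have h1 := hDF hy f hf
    have h2 := hDN hy (f * d) hfd
    have h3 : f * (d * y) = f * (y * d) := by
      rw [← mul_assoc, h2, ← mul_assoc, ← mul_assoc, h1]
    exact (mul_left_cancel h3).symm
  exact mul_mem (hCT hc) (hFT ⟨mul_mem hf (hZF hdZ), hfd⟩)

theorem isFittingFormation_isQuasinilpotent :
    IsFittingFormation.{u} (fun G _ => IsQuasinilpotent G) where
  of_subsingleton _ _ _ := Subsingleton.elim _ _
  of_surjective f hf h := by
    have h1 := map_genFitting_le f hf
    rw [show genFitting _ = ⊤ from h, Subgroup.map_top_of_surjective f hf] at h1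
    exact top_le_iff.1 h1
  of_normal N _ h := h.of_normal N
  of_sup_eq_top M N hMn hNn hM hN h := by
    refine top_le_iff.1 (h ▸ sup_le ?_ ?_)
    · have h1 := map_genFitting_subtype_le hMn.isSubnormal
      rwa [show genFitting M = ⊤ from hM, ← MonoidHom.range_eq_map, Subgroup.range_subtype] at h1
    · have h1 := map_genFitting_subtype_le hNn.isSubnormal
      rwa [show genFitting N = ⊤ from hN, ← MonoidHom.range_eq_map, Subgroup.range_subtype] at h1

theorem genFitting_eq_radical (G : Type u) [Group G] [Finite G] :
    genFitting G = radical (fun G _ => IsQuasinilpotent G) G := by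
  apply le_antisymm
  · refine le_sSup ⟨genFitting_normal G, isQuasinilpotent_of_le_map_genFitting ?_⟩
    refine sup_le ?_ (sSup_le fun Q hQ => ?_)
    · exact le_map_genFitting_of_isNilpotent (fitting_normal G).isSubnormal
        (isNilpotent_fitting G) le_sup_left
    · exact le_map_genFitting_of_isQuasisimple hQ.1 hQ.2
        (le_genFitting_of_isQuasisimple hQ.1 hQ.2)
  · refine sSup_le fun N hN => ?_
    have h1 := map_genFitting_subtype_le hN.1.isSubnormal
    rwa [show genFitting N = ⊤ from hN.2, ← MonoidHom.range_eq_map,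
      Subgroup.range_subtype] at h1

/-- A minimal nontrivial subnormal subgroup is simple, as subnormality is transitive. -/
theorem exists_isSimpleGroup_isSubnormal (G : Type u) [Group G] [Finite G] [Nontrivial G] :
    ∃ K : Subgroup G, K.IsSubnormal ∧ IsSimpleGroup K := by
  obtain ⟨K, hK⟩ := (Set.toFinite {K : Subgroup G | K.IsSubnormal ∧ K ≠ ⊥}).exists_minimal
    ⟨⊤, Subgroup.IsSubnormal.top, top_ne_bot⟩
  have hn : Nontrivial K := (Subgroup.nontrivial_iff_ne_bot K).2 hK.prop.2
  refine ⟨K, hK.prop.1, ⟨fun A hA => ?_⟩⟩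
  rw [or_iff_not_imp_left]
  intro hne
  have h1 : K ≤ A.map K.subtype := hK.le_of_le
    ⟨hA.isSubnormal.trans' hK.prop.1, fun h =>
      hne ((Subgroup.map_eq_bot_iff_of_injective _ K.subtype_injective).1 h)⟩
    (Subgroup.map_subtype_le A)
  refine top_le_iff.1 fun x _ => ?_
  obtain ⟨y, hy, hyx⟩ := h1 x.2
  rwa [← Subtype.ext hyx]

theorem genFitting_ne_bot (G : Type u) [Group G] [Finite G] [Nontrivial G] :
    genFitting G ≠ ⊥ := by
  obtain ⟨K, hK, hs⟩ := exists_isSimpleGroup_isSubnormal G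
  have hne : K ≠ ⊥ := (Subgroup.nontrivial_iff_ne_bot K).1 hs.toNontrivial
  suffices h : K ≤ genFitting G from fun hb => hne (le_bot_iff.1 (hb ▸ h))
  by_cases hc : ∀ a b : K, a * b = b * a
  · exact le_genFitting_of_isNilpotent hK (isNilpotent_of_mul_comm hc)
  · push Not at hc
    exact le_genFitting_of_isQuasisimple hK (IsNonabelianSimple.isQuasisimple ⟨hs, hc⟩)

/-! ### Internal direct products of simple groups -/

section InternalProduct

variable {G : Type u} [Group G] {ι : Type*} {S : ι → Subgroup G}

theorem iSupIndep_of_commute (hS : ∀ i, Subgroup.center (S i) = ⊥)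
    (hcomm : Pairwise fun i j => ∀ x y : G, x ∈ S i → y ∈ S j → Commute x y) : iSupIndep S := by
  intro i
  rw [disjoint_iff, eq_bot_iff]
  rintro x ⟨hx, hx'⟩
  have h1 : (⨆ (j) (_ : j ≠ i), S j) ≤ Subgroup.centralizer (S i : Set G) :=
    iSup₂_le fun j hj y hy z hz => hcomm hj.symm z y hz hy
  have h2 : (⟨x, hx⟩ : S i) ∈ Subgroup.center (S i) :=
    Subgroup.mem_center_iff.2 fun g => Subtype.ext (h1 hx' g g.2)
  rw [hS i, Subgroup.mem_bot] at h2
  exact congrArg Subtype.val h2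

/-- The internal direct product of pairwise commuting subgroups with trivial centres. -/
noncomputable def internalProductEquiv [Fintype ι] (hS : ∀ i, Subgroup.center (S i) = ⊥)
    (hcomm : Pairwise fun i j => ∀ x y : G, x ∈ S i → y ∈ S j → Commute x y) :
    (∀ i, S i) ≃* ↥(⨆ i, S i) :=
  (MonoidHom.ofInjective (Subgroup.injective_noncommPiCoprod_of_iSupIndep
    (hcomm := hcomm) (iSupIndep_of_commute hS hcomm))).trans
    (MulEquiv.subgroupCongr Subgroup.noncommPiCoprod_range)

theorem internalProductEquiv_mulSingle [Fintype ι] [DecidableEq ι]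
    (hS : ∀ i, Subgroup.center (S i) = ⊥)
    (hcomm : Pairwise fun i j => ∀ x y : G, x ∈ S i → y ∈ S j → Commute x y) (i : ι) (x : S i) :
    (internalProductEquiv hS hcomm (Pi.mulSingle i x) : G) = x :=
  Subgroup.noncommPiCoprod_mulSingle (hcomm := hcomm) i x

end InternalProduct

theorem isNonabelianSimple_of_fitting_eq_bot {G : Type u} [Group G] [Finite G]
    (hF : fitting G = ⊥) {Q : Subgroup G} (hQs : Q.IsSubnormal) (hQ : IsQuasisimple Q) :
    IsNonabelianSimple Q := by
  have h1 : Subgroup.center Q = ⊥ := by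
    rw [← Subgroup.map_eq_bot_iff_of_injective _ Q.subtype_injective, ← le_bot_iff, ← hF]
    refine le_fitting_of_isSubnormal (Subgroup.IsSubnormal.trans'
      (Subgroup.Normal.isSubnormal inferInstance) hQs) ?_
    refine isFittingFormation_isNilpotent.map Q.subtype _ (isNilpotent_of_mul_comm fun a b => ?_)
    exact Subtype.ext (Subgroup.mem_center_iff.1 b.2 a)
  exact hQ.2.of_equiv ((QuotientGroup.quotientMulEquivOfEq h1).trans QuotientGroup.quotientBot)

theorem commute_of_isQuasisimple {G : Type u} [Group G] {P Q : Subgroup G}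
    (hP : IsQuasisimple P) (hPs : P.IsSubnormal) (hQ : IsQuasisimple Q) (hQs : Q.IsSubnormal)
    (hne : P ≠ Q) (x y : G) (hx : x ∈ P) (hy : y ∈ Q) : Commute x y :=
  ((Subgroup.commutator_eq_bot_iff_le_centralizer.1
    ((hP.eq_or_commutator_eq_bot hPs hQ hQs).resolve_left hne)) hx y hy).symm

/-- The centre of a component is subnormal and abelian, so it lies in $F(G)=1$. Hence the components
are simple, and distinct ones commute, which makes their product direct. -/
theorem isProductOfNonabelianSimple_genFitting {G : Type u} [Group G] [Finite G]
    (hF : fitting G = ⊥) : IsProductOfNonabelianSimple (genFitting G) := by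
  let 𝒬 := {Q : Subgroup G | Q.IsSubnormal ∧ IsQuasisimple Q}
  let e : 𝒬 ≃ Fin (Nat.card 𝒬) := Finite.equivFin 𝒬
  let S : Fin (Nat.card 𝒬) → Subgroup G := fun i => (e.symm i).1
  have hS : ∀ i, IsNonabelianSimple (S i) := fun i =>
    isNonabelianSimple_of_fitting_eq_bot hF (e.symm i).2.1 (e.symm i).2.2
  have hcomm : Pairwise fun i j => ∀ x y : G, x ∈ S i → y ∈ S j → Commute x y :=
    fun i j hij => commute_of_isQuasisimple (e.symm i).2.2 (e.symm i).2.1 (e.symm j).2.2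
      (e.symm j).2.1 fun h => hij (e.symm.injective (Subtype.ext h))
  have hsup : (⨆ i, S i) = genFitting G := by
    rw [genFitting, hF, bot_sup_eq, sSup_eq_iSup', e.symm.iSup_comp (g := fun Q : 𝒬 => Q.1)]
  exact ⟨_, fun i => S i, inferInstance, hS,
    ⟨((internalProductEquiv (fun i => (hS i).center_eq_bot) hcomm).trans
      (MulEquiv.subgroupCongr hsup)).symm⟩⟩

theorem IsProductOfNonabelianSimple.isQuasinilpotent {G : Type u} [Group G] [Finite G]
    (h : IsProductOfNonabelianSimple G) : IsQuasinilpotent G := by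
  obtain ⟨r, T, _, hT, ⟨e⟩⟩ := h
  have : Finite (∀ i, T i) := Finite.of_equiv G e.toEquiv
  refine isFittingFormation_isQuasinilpotent.of_mulEquiv e.symm ?_
  refine top_le_iff.1 fun x _ => Subgroup.pi_mem_of_mulSingle_mem x fun i => ?_
  have h1 : (MonoidHom.mulSingle T i).range ≤ genFitting (∀ i, T i) := by
    refine le_genFitting_of_isQuasisimple (Subgroup.Normal.isSubnormal ⟨?_⟩) ?_
    · rintro _ ⟨y, rfl⟩ g
      refine ⟨g i * y * (g i)⁻¹, ?_⟩
      ext j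
      rcases eq_or_ne j i with rfl | hj
      · simp
      · simp [Pi.mulSingle_eq_of_ne hj]
    · exact (hT i).isQuasisimple.of_equiv
        (MonoidHom.ofInjective (f := MonoidHom.mulSingle T i) (Pi.mulSingle_injective i))
  exact h1 ⟨x i, rfl⟩

/-! ### Iterated extension classes -/

namespace IsFittingFormation

variable {C D E : ∀ (G : Type u) [Group G], Prop} {G : Type u} [Group G] [Finite G]

theorem quotient_radical_subgroupOf (hC : IsFittingFormation C) (hD : IsFittingFormation D)
    (M : Subgroup G) (hM : M.IsSubnormal) (h : ExtensionClass C D M) :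
    D (M ⧸ (radical C G).subgroupOf M) := by
  refine hD.quotient_of_le ?_ ((hC.extensionClass_iff hD).1 h)
  rw [Subgroup.subgroupOf, ← Subgroup.map_le_iff_le_comap]
  exact hC.le_radical_of_isSubnormal
    (Subgroup.IsSubnormal.trans' (radical_normal C M).isSubnormal hM) (hC.map _ _ hC.radical_mem)

theorem extensionClass_of_left (hD : IsFittingFormation D) (hC : IsFittingFormation C)
    (h : C G) : ExtensionClass C D G :=
  ⟨⊤, inferInstance, hC.of_mulEquiv Subgroup.topEquiv.symm h,
    haveI : Subsingleton (G ⧸ (⊤ : Subgroup G)) := QuotientGroup.subsingleton_quotient_top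
    hD.of_subsingleton _⟩

theorem extensionClass_assoc (hC : IsFittingFormation C) (hD : IsFittingFormation D)
    (hE : IsFittingFormation E) (h : ExtensionClass (ExtensionClass C D) E G) :
    ExtensionClass C (ExtensionClass D E) G := by
  obtain ⟨N, hN, h1, h2⟩ := h
  have hn : (N.map (QuotientGroup.mk' (radical C G))).Normal :=
    hN.map _ (QuotientGroup.mk'_surjective _)
  refine ⟨radical C G, inferInstance, hC.radical_mem, N.map (QuotientGroup.mk' (radical C G)), hn,
    hC.of_quotient_subgroupOf_radical hD N hN.isSubnormal h1, ?_⟩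
  refine hE.of_surjective (QuotientGroup.map N (N.map (QuotientGroup.mk' (radical C G)))
    (QuotientGroup.mk' (radical C G)) (Subgroup.le_comap_map _ N)) ?_ h2
  exact QuotientGroup.map_surjective_of_surjective _ _ _
    ((QuotientGroup.mk'_surjective _).comp (QuotientGroup.mk'_surjective _)) _

/-- The quotient by the `C`-by-`D` radical is the iterated quotient by the `C`-radical and then by
the `D`-radical. -/
theorem extensionClass_assoc' (hC : IsFittingFormation C) (hD : IsFittingFormation D)
    (hE : IsFittingFormation E) (h : ExtensionClass C (ExtensionClass D E) G) :
    ExtensionClass (ExtensionClass C D) E G := by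
  rw [hC.extensionClass_iff (hD.extensionClass hE), hD.extensionClass_iff hE] at h
  rw [(hC.extensionClass hD).extensionClass_iff hE]
  have hle : radical C G ≤ radical (ExtensionClass C D) G :=
    le_sSup ⟨inferInstance, hD.extensionClass_of_left hC hC.radical_mem⟩
  let f : G ⧸ radical C G →* G ⧸ radical (ExtensionClass C D) G :=
    QuotientGroup.map _ _ (MonoidHom.id G) hle
  have hf : Function.Surjective f := QuotientGroup.map_surjective_of_surjective _ _ _
    ((QuotientGroup.mk'_surjective _).comp Function.surjective_id) _
  have hker : radical D (G ⧸ radical C G) ≤ f.ker := by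
    intro x hx
    obtain ⟨x, rfl⟩ := QuotientGroup.mk'_surjective _ x
    have hx' : x ∈ radical (ExtensionClass C D) G := by
      rw [hC.radical_extensionClass hD]
      exact hx
    exact (QuotientGroup.eq_one_iff x).2 hx'
  exact hE.of_surjective (QuotientGroup.lift _ f hker)
    (QuotientGroup.lift_surjective_of_surjective _ _ hf _) h

end IsFittingFormation

theorem ExtensionClass.mono_right {C D E : ∀ (G : Type u) [Group G], Prop} {G : Type u} [Group G]
    [Finite G] (hDE : ∀ (H : Type u) [Group H] [Finite H], D H → E H)
    (h : ExtensionClass C D G) : ExtensionClass C E G := by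
  obtain ⟨N, hN, h1, h2⟩ := h
  exact ⟨N, hN, h1, hDE _ h2⟩

theorem exists_mem_of_extensionClass_isQuasinilpotent
    {C : ℕ → ∀ (G : Type u) [Group G], Prop} (hC : ∀ i, IsFittingFormation (C i))
    (hstep : ∀ (i : ℕ) (G : Type u) [Group G] [Finite G],
      ExtensionClass (C i) (fun G _ => IsQuasinilpotent G) G → C (i + 1) G)
    (G : Type u) [Group G] [Finite G] : ∃ i, C i G := by
  have hX := isFittingFormation_isQuasinilpotent.{u}
  -- Until the radicals reach `G` they grow strictly, since $F^*$ of a nontrivial finite group is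
  -- nontrivial; so index $|G|$ suffices.
  have key : ∀ i, radical (C i) G = ⊤ ∨ i < Nat.card (radical (C i) G) := by
    intro i
    induction i with
    | zero => exact Or.inr Nat.card_pos
    | succ i ih =>
      rcases ih with h | h
      · left
        rw [(hC _).radical_eq_top_iff] at h ⊢
        exact hstep i G (hX.extensionClass_of_left (hC i) h)
      · by_cases ht : radical (C i) G = ⊤
        · left
          rw [(hC _).radical_eq_top_iff] at ht ⊢
          exact hstep i G (hX.extensionClass_of_left (hC i) ht)
        · right
          have : Nontrivial (G ⧸ radical (C i) G) := QuotientGroup.nontrivial_iff.2 ht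
          have h1 := genFitting_ne_bot (G ⧸ radical (C i) G)
          rw [genFitting_eq_radical] at h1
          have h2 : radical (C i) G < radical (C (i + 1)) G := by
            refine lt_of_lt_of_le (b := radical (ExtensionClass (C i)
              (fun G _ => IsQuasinilpotent G)) G) ?_
              (sSup_le_sSup fun N hN => ⟨hN.1, hstep i N hN.2⟩)
            rw [(hC i).radical_extensionClass hX]
            refine lt_of_le_of_ne (fun x hx => ?_) fun h => h1 ?_
            · have : QuotientGroup.mk' (radical (C i) G) x = 1 :=
                (QuotientGroup.eq_one_iff x).2 hx
              rw [Subgroup.mem_comap, this]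
              exact one_mem _
            · have h3 := congrArg (Subgroup.map (QuotientGroup.mk' (radical (C i) G))) h
              rw [Subgroup.map_comap_eq_self_of_surjective (QuotientGroup.mk'_surjective _),
                QuotientGroup.map_mk'_self] at h3
              exact h3.symm
          have h3 := Set.ncard_lt_ncard (SetLike.coe_ssubset_coe.2 h2) (Set.toFinite _)
          rw [← Nat.card_coe_set_eq, ← Nat.card_coe_set_eq] at h3
          exact lt_of_le_of_lt (Nat.succ_le_of_lt h) h3
  refine ⟨Nat.card G, (hC _).radical_eq_top_iff.1 ((key (Nat.card G)).resolve_right ?_)⟩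
  exact not_lt.2 (Subgroup.card_le_card_group _)

/-! ### The generalized Fitting series as a series of radicals -/

/-- The groups with a normal series of length `k` with quasinilpotent factors. -/
def GenFittingClass : ℕ → ∀ (G : Type u) [Group G], Prop
  | 0 => fun G _ => Subsingleton G
  | k + 1 => ExtensionClass (GenFittingClass k) fun G _ => IsQuasinilpotent G

theorem isFittingFormation_genFittingClass (k : ℕ) :
    IsFittingFormation (GenFittingClass.{u} k) := by
  induction k with
  | zero =>
    exact
      { of_subsingleton := fun _ _ h => h
        of_surjective := fun f hf h => by
          have : Subsingleton _ := h
          exact hf.subsingleton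
        of_normal := fun N _ h => by
          have : Subsingleton _ := h
          exact (inferInstance : Subsingleton N)
        of_sup_eq_top := fun M N _ _ hM hN h => by
          have hM' : Subsingleton M := hM
          have hN' : Subsingleton N := hN
          rw [Subgroup.eq_bot_of_subsingleton M, Subgroup.eq_bot_of_subsingleton N,
            bot_sup_eq] at h
          exact Subgroup.subsingleton_iff.1 (subsingleton_of_bot_eq_top h) }
  | succ k ih => exact ih.extensionClass isFittingFormation_isQuasinilpotent

theorem genFittingSeries_eq_radical (G : Type u) [Group G] [Finite G] (k : ℕ) :
    genFittingSeries G k = radical (GenFittingClass k) G := by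
  induction k with
  | zero =>
    refine (le_bot_iff.1 (sSup_le fun N hN => ?_)).symm
    have : Subsingleton N := hN.2
    exact (Subgroup.eq_bot_of_subsingleton N).le
  | succ k ih =>
    -- The quotient depends on `N` and its normality proof, so the term is generalized before the
    -- equality is substituted.
    have key : ∀ (N : Subgroup G) (_ : N.Normal), N = radical (GenFittingClass k) G →
        (genFitting (G ⧸ N)).comap (QuotientGroup.mk' N) =
          radical (GenFittingClass (k + 1)) G := by
      rintro N hN rfl
      rw [genFitting_eq_radical]
      exact ((isFittingFormation_genFittingClass k).radical_extensionClass
        isFittingFormation_isQuasinilpotent).symm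
    exact key _ (genFittingSeriesAux G k).2 ih

theorem genFittingClass_genFittingHeight (G : Type u) [Group G] [Finite G] :
    GenFittingClass (genFittingHeight G) G := by
  have h : genFittingHeight G ∈ {h : ℕ | genFittingSeries G h = ⊤} := by
    apply Nat.sInf_mem
    obtain ⟨i, hi⟩ := exists_mem_of_extensionClass_isQuasinilpotent
      isFittingFormation_genFittingClass.{u} (fun _ _ _ _ h => h) G
    refine ⟨i, ?_⟩
    rw [Set.mem_ofPred_eq, genFittingSeries_eq_radical]
    exact (isFittingFormation_genFittingClass i).radical_eq_top_iff.2 hi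
  rw [Set.mem_ofPred_eq, genFittingSeries_eq_radical] at h
  exact (isFittingFormation_genFittingClass _).radical_eq_top_iff.1 h

/-! ### Nonsoluble length through extension classes -/

/-- The groups of nonsoluble length at most `k`, as iterated extensions. -/
def NonsolubleClass : ℕ → ∀ (G : Type u) [Group G], Prop
  | 0 => fun G _ => Group.IsSolvable G
  | k + 1 => ExtensionClass (NonsolubleClass k)
      (ExtensionClass (fun G _ => IsQuasinilpotent G) fun G _ => Group.IsSolvable G)

theorem isFittingFormation_nonsolubleClass (k : ℕ) :
    IsFittingFormation (NonsolubleClass.{u} k) := by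
  induction k with
  | zero => exact isFittingFormation_isSolvable
  | succ k ih =>
    exact ih.extensionClass
      (isFittingFormation_isQuasinilpotent.extensionClass isFittingFormation_isSolvable)

theorem nonsolubleClass_succ_of_isQuasinilpotent (k : ℕ) (G : Type u) [Group G] [Finite G]
    (h : ExtensionClass (NonsolubleClass k) (fun G _ => IsQuasinilpotent G) G) :
    NonsolubleClass (k + 1) G :=
  h.mono_right fun _ _ _ hH =>
    isFittingFormation_isSolvable.extensionClass_of_left isFittingFormation_isQuasinilpotent hH

theorem isSolvable_of_extensionClass {G : Type u} [Group G]
    (h : ExtensionClass (fun G _ => Group.IsSolvable G) (fun G _ => Group.IsSolvable G) G) :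
    Group.IsSolvable G := by
  obtain ⟨N, hN, h1, h2⟩ := h
  exact (Group.isSolvable_iff_subgroup_quotient N).2 ⟨h1, h2⟩

/-- For `k + 1` the last layer is already quasinilpotent-by-soluble; reassociating the extensions
merges the extra soluble quotient with its soluble part. -/
theorem nonsolubleClass_of_isSolvable (k : ℕ) (G : Type u) [Group G] [Finite G]
    (h : ExtensionClass (NonsolubleClass k) (fun G _ => Group.IsSolvable G) G) :
    NonsolubleClass k G := by
  cases k with
  | zero => exact isSolvable_of_extensionClass h
  | succ k =>
    have hX := isFittingFormation_isQuasinilpotent.{u}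
    have hS := isFittingFormation_isSolvable.{u}
    refine ((isFittingFormation_nonsolubleClass k).extensionClass_assoc
      (hX.extensionClass hS) hS h).mono_right fun H _ _ hH => ?_
    exact (hX.extensionClass_assoc hS hS hH).mono_right fun _ _ _ => isSolvable_of_extensionClass

theorem SolubleSimpleSeries.nonsolubleClass {G : Type u} [Group G] [Finite G]
    (s : SolubleSimpleSeries G) : NonsolubleClass s.numNonsoluble G := by
  classical
  have := s.normal
  let c : ℕ → ℕ := fun j => ((Finset.range j).filter fun i =>
    ¬ Group.IsSolvable (s.term (i + 1) ⧸ (s.term i).subgroupOf (s.term (i + 1)))).card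
  have key : ∀ j ≤ s.length, NonsolubleClass (c j) (s.term j) := by
    intro j
    induction j with
    | zero =>
      intro _
      rw [s.term_zero]
      exact (isFittingFormation_nonsolubleClass _).of_subsingleton _
    | succ j ih =>
      intro hj
      have h1 := ih (by omega)
      have hle := s.mono j (by omega)
      have hF := isFittingFormation_nonsolubleClass.{u} (c j)
      by_cases hs : Group.IsSolvable (s.term (j + 1) ⧸ (s.term j).subgroupOf (s.term (j + 1)))
      · have hc : c (j + 1) = c j := by
          simp only [c, Finset.range_add_one]
          rw [Finset.filter_insert, if_neg (not_not.2 hs)]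
        rw [hc]
        exact nonsolubleClass_of_isSolvable _ _ (hF.extensionClass_of_subgroupOf hle h1 hs)
      · have hc : c (j + 1) = c j + 1 := by
          simp only [c, Finset.range_add_one]
          rw [Finset.filter_insert, if_pos hs, Finset.card_insert_of_notMem (by simp)]
        rw [hc]
        have h2 := ((s.factor j (by omega)).resolve_left hs).isQuasinilpotent
        exact nonsolubleClass_succ_of_isQuasinilpotent _ _
          (hF.extensionClass_of_subgroupOf hle h1 h2)
  have h := key s.length le_rfl
  rw [s.term_length] at h
  have h' := (isFittingFormation_nonsolubleClass _).of_mulEquiv Subgroup.topEquiv h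
  have hc : s.numNonsoluble = c s.length := by
    unfold SolubleSimpleSeries.numNonsoluble
    congr
  rwa [hc]

/-- The preimage of a soluble normal subgroup of the quotient still belongs to the class, so it lies
in the radical. -/
theorem fitting_quotient_radical_nonsolubleClass (G : Type u) [Group G] [Finite G] (k : ℕ) :
    fitting (G ⧸ radical (NonsolubleClass k) G) = ⊥ := by
  have hF := isFittingFormation_nonsolubleClass.{u} k
  have hS := isFittingFormation_isSolvable.{u}
  set R := radical (NonsolubleClass k) G
  have h1 : (radical (fun G _ => Group.IsSolvable G) (G ⧸ R)).comap (QuotientGroup.mk' R) ≤ R := by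
    refine (hF.radical_extensionClass hS).ge.trans ?_
    exact sSup_le_sSup fun N hN => ⟨hN.1, nonsolubleClass_of_isSolvable k N hN.2⟩
  have h2 : fitting (G ⧸ R) ≤ radical (fun G _ => Group.IsSolvable G) (G ⧸ R) :=
    sSup_le_sSup fun N hN => ⟨hN.1, have := hN.2; inferInstance⟩
  rw [eq_bot_iff]
  intro x hx
  obtain ⟨x, rfl⟩ := QuotientGroup.mk'_surjective R x
  exact (QuotientGroup.eq_one_iff x).2 (h1 (h2 hx))

/-- The upper series of radicals: the terms with index `2 i + 1` are the radicals of nonsoluble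
length at most `i`, each followed by the inverse image of `F^*` of the quotient by it. -/
def upperNonsolubleTerm (G : Type u) [Group G] : ℕ → Subgroup G
  | 0 => ⊥
  | j + 1 => if Even j then radical (NonsolubleClass (j / 2)) G else
      (genFitting (G ⧸ radical (NonsolubleClass (j / 2)) G)).comap (QuotientGroup.mk' _)

/-! ### The upper series realizing the nonsoluble length -/

section UpperSeries

variable (G : Type u) [Group G]

theorem upperNonsolubleTerm_odd (i : ℕ) :
    upperNonsolubleTerm G (2 * i + 1) = radical (NonsolubleClass i) G := by
  simp [upperNonsolubleTerm]

theorem upperNonsolubleTerm_even (i : ℕ) :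
    upperNonsolubleTerm G (2 * i + 2) =
      (genFitting (G ⧸ radical (NonsolubleClass i) G)).comap (QuotientGroup.mk' _) := by
  have h1 : ¬ Even (2 * i + 1) := by simp
  have h2 : (2 * i + 1) / 2 = i := by omega
  rw [upperNonsolubleTerm, if_neg h1]
  have key : ∀ m, m = i →
      (genFitting (G ⧸ radical (NonsolubleClass m) G)).comap (QuotientGroup.mk' _) =
        (genFitting (G ⧸ radical (NonsolubleClass i) G)).comap (QuotientGroup.mk' _) := by
    rintro m rfl
    rfl
  exact key _ h2

theorem upperNonsolubleTerm_normal (j : ℕ) : (upperNonsolubleTerm G j).Normal := by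
  cases j with
  | zero => exact Subgroup.normal_bot
  | succ j =>
    rw [upperNonsolubleTerm]
    split_ifs <;> infer_instance

variable [Finite G]

theorem upperNonsolubleTerm_even_eq_radical (i : ℕ) :
    upperNonsolubleTerm G (2 * i + 2) =
      radical (ExtensionClass (NonsolubleClass i) fun G _ => IsQuasinilpotent G) G := by
  rw [upperNonsolubleTerm_even, genFitting_eq_radical]
  exact ((isFittingFormation_nonsolubleClass i).radical_extensionClass
    isFittingFormation_isQuasinilpotent).symm

theorem upperNonsolubleTerm_le_succ (j : ℕ) :
    upperNonsolubleTerm G j ≤ upperNonsolubleTerm G (j + 1) := by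
  have hX := isFittingFormation_isQuasinilpotent.{u}
  obtain ⟨i, rfl | rfl⟩ := Nat.even_or_odd' j
  · cases i with
    | zero => exact bot_le
    | succ i =>
      rw [upperNonsolubleTerm_odd, show 2 * (i + 1) = 2 * i + 2 by ring,
        upperNonsolubleTerm_even_eq_radical]
      exact sSup_le_sSup fun N hN => ⟨hN.1, nonsolubleClass_succ_of_isQuasinilpotent i N hN.2⟩
  · rw [upperNonsolubleTerm_odd, upperNonsolubleTerm_even_eq_radical]
    exact sSup_le_sSup fun N hN =>
      ⟨hN.1, hX.extensionClass_of_left (isFittingFormation_nonsolubleClass i) hN.2⟩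

theorem isSolvable_upperNonsolubleTerm_factor (i : ℕ) :
    haveI := upperNonsolubleTerm_normal G
    Group.IsSolvable (upperNonsolubleTerm G (2 * i + 1) ⧸
      (upperNonsolubleTerm G (2 * i)).subgroupOf (upperNonsolubleTerm G (2 * i + 1))) := by
  have := upperNonsolubleTerm_normal G
  have hS := isFittingFormation_isSolvable.{u}
  have hX := isFittingFormation_isQuasinilpotent.{u}
  cases i with
  | zero =>
    have : Group.IsSolvable (upperNonsolubleTerm G (2 * 0 + 1)) := by
      rw [upperNonsolubleTerm_odd]
      exact hS.radical_mem
    infer_instance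
  | succ i =>
    have hU := isFittingFormation_nonsolubleClass.{u} i
    have key : ∀ A B : Subgroup G, ∀ _ : A.Normal,
        A = radical (ExtensionClass (NonsolubleClass i) fun G _ => IsQuasinilpotent G) G →
        B = radical (NonsolubleClass (i + 1)) G → Group.IsSolvable (B ⧸ A.subgroupOf B) := by
      rintro A B _ rfl rfl
      exact (hU.extensionClass hX).quotient_radical_subgroupOf hS _
        (radical_normal _ G).isSubnormal
        (hU.extensionClass_assoc' hX hS (isFittingFormation_nonsolubleClass (i + 1)).radical_mem)
    exact key _ _ (upperNonsolubleTerm_normal G _) (upperNonsolubleTerm_even_eq_radical G i)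
      (upperNonsolubleTerm_odd G (i + 1))

end UpperSeries

theorem IsProductOfNonabelianSimple.of_equiv {G H : Type u} [Group G] [Group H] (e : G ≃* H)
    (h : IsProductOfNonabelianSimple G) : IsProductOfNonabelianSimple H := by
  obtain ⟨r, T, hT, h1, ⟨f⟩⟩ := h
  exact ⟨r, T, hT, h1, ⟨e.symm.trans f⟩⟩

theorem isProductOfNonabelianSimple_upperNonsolubleTerm_factor (G : Type u) [Group G] [Finite G]
    (i : ℕ) :
    haveI := upperNonsolubleTerm_normal G
    IsProductOfNonabelianSimple (upperNonsolubleTerm G (2 * i + 1 + 1) ⧸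
      (upperNonsolubleTerm G (2 * i + 1)).subgroupOf (upperNonsolubleTerm G (2 * i + 1 + 1))) := by
  have key : ∀ A B : Subgroup G, ∀ _ : A.Normal, A = radical (NonsolubleClass i) G →
      B = (genFitting (G ⧸ radical (NonsolubleClass i) G)).comap (QuotientGroup.mk' _) →
      IsProductOfNonabelianSimple (B ⧸ A.subgroupOf B) := by
    rintro A B _ rfl rfl
    exact (isProductOfNonabelianSimple_genFitting
      (fitting_quotient_radical_nonsolubleClass G i)).of_equiv (comapQuotientEquiv _ _).symm
  exact key _ _ (upperNonsolubleTerm_normal G _) (upperNonsolubleTerm_odd G i)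
    (upperNonsolubleTerm_even G i)

/-- The upper series of radicals of a group of nonsoluble length at most `k`. -/
def upperNonsolubleSeries (G : Type u) [Group G] [Finite G] (k : ℕ) (h : NonsolubleClass k G) :
    SolubleSimpleSeries G where
  -- There are `k + 1` soluble factors at even indices, alternating with `k` products of simple
  -- groups at odd ones.
  length := 2 * k + 1
  term := upperNonsolubleTerm G
  normal := upperNonsolubleTerm_normal G
  mono j _ := upperNonsolubleTerm_le_succ G j
  term_zero := rfl
  term_length := by
    rw [upperNonsolubleTerm_odd]
    exact (isFittingFormation_nonsolubleClass k).radical_eq_top_iff.2 h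
  factor j _ := by
    obtain ⟨i, rfl | rfl⟩ := Nat.even_or_odd' j
    · exact Or.inl (isSolvable_upperNonsolubleTerm_factor G i)
    · exact Or.inr (isProductOfNonabelianSimple_upperNonsolubleTerm_factor G i)

theorem numNonsoluble_upperNonsolubleSeries_le (G : Type u) [Group G] [Finite G] (k : ℕ)
    (h : NonsolubleClass k G) : (upperNonsolubleSeries G k h).numNonsoluble ≤ k := by
  classical
  have hsub : (upperNonsolubleSeries G k h).numNonsoluble ≤
      ((Finset.range k).image fun i => 2 * i + 1).card := by
    refine Finset.card_le_card fun j hj => ?_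
    rw [Finset.mem_filter, Finset.mem_range] at hj
    have hlt : j < 2 * k + 1 := hj.1
    obtain ⟨i, rfl | rfl⟩ := Nat.even_or_odd' j
    · exact absurd (isSolvable_upperNonsolubleTerm_factor G i) hj.2
    · exact Finset.mem_image.2 ⟨i, Finset.mem_range.2 (by omega), rfl⟩
  exact hsub.trans (Finset.card_image_le.trans (Finset.card_range k).le)

theorem NonsolubleClass.mono {G : Type u} [Group G] [Finite G] {k l : ℕ} (hkl : k ≤ l)
    (h : NonsolubleClass k G) : NonsolubleClass l G := by
  induction l, hkl using Nat.le_induction with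
  | base => exact h
  | succ l _ ih =>
    exact nonsolubleClass_succ_of_isQuasinilpotent l G
      (isFittingFormation_isQuasinilpotent.extensionClass_of_left
        (isFittingFormation_nonsolubleClass l) ih)

theorem nonsolubleLength_le_iff (G : Type u) [Group G] [Finite G] (k : ℕ) :
    nonsolubleLength G ≤ k ↔ NonsolubleClass k G := by
  constructor
  · intro h
    obtain ⟨i, hi⟩ := exists_mem_of_extensionClass_isQuasinilpotent
      isFittingFormation_nonsolubleClass.{u} nonsolubleClass_succ_of_isQuasinilpotent G
    have hne : (Set.range fun s : SolubleSimpleSeries G => s.numNonsoluble).Nonempty :=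
      ⟨_, upperNonsolubleSeries G i hi, rfl⟩
    obtain ⟨s, hs⟩ := Nat.sInf_mem hne
    refine s.nonsolubleClass.mono ?_
    exact hs.le.trans h
  · intro h
    exact (Nat.sInf_le (Set.mem_range_self (upperNonsolubleSeries G k h))).trans
      (numNonsoluble_upperNonsolubleSeries_le G k h)

theorem nonsolubleRadical_eq_radical (G : Type u) [Group G] [Finite G] (k : ℕ) :
    nonsolubleRadical G k = radical (NonsolubleClass k) G := by
  refine congrArg sSup (Set.ext fun N => ?_)
  exact and_congr_right fun _ => nonsolubleLength_le_iff N k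

/-! ### Engel subgroups of automorphisms -/

section Functoriality

variable {G H : Type u} [Group G] [Group H] {α : MulAut G} {β : MulAut H}

theorem map_autEngelComm (f : G →* H) (hf : ∀ x, f (α x) = β (f x)) (n : ℕ) (x : G) :
    f (autEngelComm α n x) = autEngelComm β n (f x) := by
  induction n generalizing x with
  | zero => rfl
  | succ n ih =>
    have h1 : autEngelComm α (n + 1) x = autEngelComm α n (x⁻¹ * α x) := rfl
    have h2 : autEngelComm β (n + 1) (f x) = autEngelComm β n ((f x)⁻¹ * β (f x)) := rfl
    rw [h1, h2, ih, map_mul, map_inv, hf]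

theorem map_autEngelSubgroup_le (f : G →* H) (hf : ∀ x, f (α x) = β (f x)) (n : ℕ) :
    (autEngelSubgroup α n).map f ≤ autEngelSubgroup β n := by
  rw [autEngelSubgroup, MonoidHom.map_closure, Subgroup.closure_le]
  rintro _ ⟨_, ⟨x, rfl⟩, rfl⟩
  exact Subgroup.subset_closure ⟨f x, (map_autEngelComm f hf n x).symm⟩

theorem map_autEngelSubgroup_eq (f : G →* H) (hs : Function.Surjective f)
    (hf : ∀ x, f (α x) = β (f x)) (n : ℕ) :
    (autEngelSubgroup α n).map f = autEngelSubgroup β n := by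
  refine le_antisymm (map_autEngelSubgroup_le f hf n) ?_
  rw [autEngelSubgroup, autEngelSubgroup, MonoidHom.map_closure, Subgroup.closure_le]
  rintro _ ⟨y, rfl⟩
  obtain ⟨x, rfl⟩ := hs y
  exact Subgroup.subset_closure ⟨_, ⟨x, rfl⟩, map_autEngelComm f hf n x⟩

theorem autCommutator_eq_autEngelSubgroup (α : MulAut G) :
    autCommutator α = autEngelSubgroup α 1 := rfl

/-- The restriction of an automorphism to an invariant subgroup. -/
def restrictAut (α : MulAut G) (K : Subgroup G) (hK : K.map α.toMonoidHom = K) : MulAut K :=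
  (α.subgroupMap K).trans (MulEquiv.subgroupCongr hK)

theorem map_map_subtype_of_characteristic (α : MulAut G) (K : Subgroup G)
    (hK : K.map α.toMonoidHom = K) (X : Subgroup K) [hX : X.Characteristic] :
    (X.map K.subtype).map α.toMonoidHom = X.map K.subtype := by
  have h1 := Subgroup.characteristic_iff_map_eq.1 hX (restrictAut α K hK)
  conv_rhs => rw [← h1]
  rw [Subgroup.map_map, Subgroup.map_map]
  rfl

theorem map_autEngelSubgroup_self (α : MulAut G) (n : ℕ) :
    (autEngelSubgroup α n).map α.toMonoidHom = autEngelSubgroup α n :=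
  map_autEngelSubgroup_eq α.toMonoidHom α.surjective (fun _ => rfl) n

/-- The subgroup of fixed points of an automorphism. -/
def fixedSubgroup (α : MulAut G) : Subgroup G :=
  MonoidHom.eqLocus α.toMonoidHom (MonoidHom.id G)

/-- Conjugation by a fixed point of `α` commutes with `α`, so it permutes the generating Engel
commutators. -/
theorem fixedSubgroup_le_normalizer (α : MulAut G) (n : ℕ) :
    fixedSubgroup α ≤ Subgroup.normalizer (autEngelSubgroup α n : Set G) := by
  have key : ∀ c ∈ fixedSubgroup α, ∀ x ∈ autEngelSubgroup α n,
      c * x * c⁻¹ ∈ autEngelSubgroup α n := fun c hc x hx =>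
    map_autEngelSubgroup_le (α := α) (β := α) (MulAut.conj c).toMonoidHom (fun y => by
      have hc' : α c = c := hc
      simp [hc']) n (Subgroup.mem_map_of_mem _ hx)
  intro c hc
  rw [Subgroup.mem_normalizer_iff]
  refine fun x => ⟨key c hc x, fun hx => ?_⟩
  have := key c⁻¹ (inv_mem hc) _ hx
  simpa [mul_assoc] using this

/-- Here `E` is normal, and for $x=ew$ with $e\in E$ and $w$ fixed, $[x,\alpha]=w^{-1}[e,\alpha]w\in
E$. These commutators generate the group. -/
theorem autEngelSubgroup_eq_top_of_sup_fixedSubgroup (n : ℕ) (hα : autCommutator α = ⊤)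
    (h : autEngelSubgroup α n ⊔ fixedSubgroup α = ⊤) : autEngelSubgroup α n = ⊤ := by
  set E := autEngelSubgroup α n with hE
  have hn : E.Normal := by
    rw [← Subgroup.normalizer_eq_top_iff, ← top_le_iff, ← h]
    exact sup_le Subgroup.le_normalizer (fixedSubgroup_le_normalizer α n)
  rw [← top_le_iff, ← hα, autCommutator, Subgroup.closure_le]
  rintro _ ⟨x, rfl⟩
  obtain ⟨e, he, w, hw, rfl⟩ := Subgroup.mem_sup_of_normal_left.1
    (h.ge (Subgroup.mem_top x) : x ∈ E ⊔ fixedSubgroup α)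
  have hw' : α w = w := hw
  have he' : α e ∈ E := by
    rw [hE, ← map_autEngelSubgroup_self α n]
    exact Subgroup.mem_map_of_mem _ he
  have h1 := hn.conj_mem _ (mul_mem (inv_mem he) he') w⁻¹
  simpa [hw', mul_assoc] using h1

/-- Without nontrivial fixed points, $x\mapsto[x,\alpha]$ is injective on the finite group `M`,
hence bijective, and so are its iterates: every element of `M` is itself an Engel commutator. -/
theorem le_autEngelSubgroup_of_fixedSubgroup_inf_eq_bot [Finite G] (n : ℕ) {M : Subgroup G}
    (hM : M.map α.toMonoidHom = M) (h : M ⊓ fixedSubgroup α = ⊥) : M ≤ autEngelSubgroup α n := by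
  let β := restrictAut α M hM
  have hinj : Function.Injective fun x : M => x⁻¹ * β x := by
    intro x y hxy
    have h1 : α (x * (y : G)⁻¹) = x * (y : G)⁻¹ := by
      have h2 : (x : G)⁻¹ * α x = (y : G)⁻¹ * α y := congrArg Subtype.val hxy
      rw [map_mul, map_inv]
      rw [inv_mul_eq_iff_eq_mul] at h2
      rw [h2]
      group
    have h3 : (x * (y : G)⁻¹) ∈ M ⊓ fixedSubgroup α := ⟨M.mul_mem x.2 (M.inv_mem y.2), h1⟩
    rw [h, Subgroup.mem_bot, mul_inv_eq_one] at h3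
    exact Subtype.ext h3
  have hsurj : Function.Surjective (autEngelComm β n) :=
    (Finite.surjective_of_injective hinj).iterate n
  intro x hx
  obtain ⟨y, hy⟩ := hsurj ⟨x, hx⟩
  refine Subgroup.subset_closure ⟨y, ?_⟩
  have := map_autEngelComm (α := β) (β := α) M.subtype (fun _ => rfl) n y
  rw [hy] at this
  exact this.symm

end Functoriality

/-! ### Orbits of subnormal simple subgroups -/

/-- The images of `Q` under powers of `α` are commuting simple subgroups, so they generate a direct
product whose factors `α` permutes transitively. The hypothesis on simple groups applies unless `α`
is trivial on this product. -/
theorem le_fixedSubgroup_or_le_autEngelSubgroup {n : ℕ}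
    (hS : EngelGeneratesSimpleProducts.{u} n) {G : Type u} [Group G] [Finite G] (α : MulAut G)
    {Q : Subgroup G} (hQs : Q.IsSubnormal) (hQ : IsNonabelianSimple Q) :
    Q ≤ fixedSubgroup α ∨ Q ≤ autEngelSubgroup α n := by
  classical
  have := Fintype.ofFinite (Subgroup G)
  let τ : Equiv.Perm (Subgroup G) := (MulEquiv.mapSubgroup α).toEquiv
  have hτ : ∀ K, τ K = K.map α.toMonoidHom := fun _ => rfl
  let O : Set (Subgroup G) := {K | τ.SameCycle Q K}
  have hτO : ∀ K, K ∈ O ↔ τ K ∈ O := fun K => Equiv.Perm.sameCycle_apply_right.symm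
  have hO : ∀ K ∈ O, K.IsSubnormal ∧ IsNonabelianSimple K := by
    intro K hK
    obtain ⟨i, -, -, hi⟩ := Equiv.Perm.SameCycle.exists_pow_eq τ hK
    rw [← hi]
    clear hi hK
    induction i with
    | zero => exact ⟨hQs, hQ⟩
    | succ i ih =>
      rw [pow_succ', Equiv.Perm.mul_apply, hτ]
      exact ⟨ih.1.map α.surjective, ih.2.of_equiv (Subgroup.equivMapOfInjective _ _ α.injective)⟩
  let e : O ≃ Fin (Nat.card O) := Finite.equivFin O
  let S : Fin (Nat.card O) → Subgroup G := fun i => (e.symm i).1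
  let σ : Equiv.Perm (Fin (Nat.card O)) := e.permCongr (τ.subtypePerm fun K => (hτO K).symm)
  have hσ : ∀ i, S (σ i) = (S i).map α.toMonoidHom := fun i => by
    simp only [S, σ, Equiv.permCongr_apply, Equiv.symm_apply_apply]
    rfl
  have hσk : ∀ (k : ℕ) i, S ((σ ^ k) i) = (τ ^ k) (S i) := by
    intro k i
    induction k with
    | zero => rfl
    | succ k ih => rw [pow_succ', pow_succ', Equiv.Perm.mul_apply, Equiv.Perm.mul_apply, hσ, ih, hτ]
  have hSinj : Function.Injective S := Subtype.val_injective.comp e.symm.injective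
  have htrans : ∀ i j, σ.SameCycle i j := by
    intro i j
    have h1 : τ.SameCycle (S i) (S j) := (e.symm i).2.symm.trans (e.symm j).2
    obtain ⟨k, -, -, hk⟩ := Equiv.Perm.SameCycle.exists_pow_eq τ h1
    refine ⟨k, hSinj ?_⟩
    rw [zpow_natCast, hσk, hk]
  have hsimple : ∀ i, IsNonabelianSimple (S i) := fun i => (hO _ (e.symm i).2).2
  have hcent : ∀ i, Subgroup.center (S i) = ⊥ := fun i => (hsimple i).center_eq_bot
  have hcomm : Pairwise fun i j => ∀ x y : G, x ∈ S i → y ∈ S j → Commute x y :=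
    fun i j hij => commute_of_isQuasisimple (hsimple i).isQuasisimple (hO _ (e.symm i).2).1
      (hsimple j).isQuasisimple (hO _ (e.symm j).2).1 fun h => hij (hSinj h)
  let P : Subgroup G := ⨆ i, S i
  have hP : P.map α.toMonoidHom = P := by
    simp only [P, Subgroup.map_iSup, ← hσ]
    exact σ.iSup_comp (g := S)
  let ψ : (∀ i, S i) ≃* P := internalProductEquiv hcent hcomm
  let φ : MulAut (∀ i, S i) := (ψ.trans (restrictAut α P hP)).trans ψ.symm
  have hψφ : ∀ x, (ψ (φ x) : G) = α (ψ x) := fun x =>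
    congrArg Subtype.val (ψ.apply_symm_apply (restrictAut α P hP (ψ x)))
  have hsingle : ∀ i (x : S i), (ψ (Pi.mulSingle i x) : G) = x :=
    internalProductEquiv_mulSingle hcent hcomm
  have hαS : ∀ i (x : S i), α x ∈ S (σ i) := fun i x => by
    rw [hσ]
    exact Subgroup.mem_map_of_mem _ x.2
  have hφsingle : ∀ i (x : S i),
      φ (Pi.mulSingle i x) = Pi.mulSingle (σ i) (⟨α x, hαS i x⟩ : S (σ i)) := fun i x => by
    apply ψ.injective
    apply Subtype.ext
    rw [hψφ, hsingle, hsingle]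
  have hperm : PermutesFactorsTransitively (fun i => S i) φ := by
    refine ⟨σ, fun i => le_antisymm ?_ ?_, htrans⟩
    · rintro _ ⟨_, ⟨x, rfl⟩, rfl⟩
      exact ⟨⟨α x, hαS i x⟩, (hφsingle i x).symm⟩
    · rintro _ ⟨⟨y, hy⟩, rfl⟩
      have hy' := hy
      rw [hσ] at hy'
      obtain ⟨x, hx, rfl⟩ := hy'
      exact ⟨_, ⟨⟨x, hx⟩, rfl⟩, hφsingle i ⟨x, hx⟩⟩
  have hQO : Q ∈ O := Equiv.Perm.SameCycle.refl τ Q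
  have hQS : S (e ⟨Q, hQO⟩) = Q := congrArg Subtype.val (e.symm_apply_apply _)
  by_cases hφ : φ = 1
  · left
    intro x hx
    rw [← hQS] at hx
    have h1 := hψφ (Pi.mulSingle (e ⟨Q, hQO⟩) ⟨x, hx⟩)
    rw [hφ, MulAut.one_apply, hsingle] at h1
    exact h1.symm
  · right
    have h1 := hS _ (fun i => S i) hsimple φ hφ hperm
    have h2 := map_autEngelSubgroup_le (α := φ) (β := α) (P.subtype.comp ψ.toMonoidHom) hψφ n
    rw [h1] at h2
    intro x hx
    rw [← hQS] at hx
    refine h2 ⟨Pi.mulSingle (e ⟨Q, hQO⟩) ⟨x, hx⟩, Subgroup.mem_top _, ?_⟩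
    exact hsingle (e ⟨Q, hQO⟩) ⟨x, hx⟩

/-! ### Groups generated by commutators with an automorphism -/

theorem autEngelSubgroup_eq_top_of_fitting_eq_bot {n : ℕ}
    (hS : EngelGeneratesSimpleProducts.{u} n) {G : Type u} [Group G] [Finite G] {α : MulAut G}
    (hα : autCommutator α = ⊤) (hF : fitting G = ⊥)
    (hE : autEngelSubgroup α n ⊔ genFitting G = ⊤) : autEngelSubgroup α n = ⊤ := by
  refine autEngelSubgroup_eq_top_of_sup_fixedSubgroup n hα (top_le_iff.1 ?_)
  rw [← hE, genFitting, hF, bot_sup_eq]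
  refine sup_le le_sup_left (sSup_le fun Q hQ => ?_)
  rcases le_fixedSubgroup_or_le_autEngelSubgroup hS α hQ.1
    (isNonabelianSimple_of_fitting_eq_bot hF hQ.1 hQ.2) with h | h
  · exact h.trans le_sup_right
  · exact h.trans le_sup_left

/-- The intersection $E\cap M$ is normalized by `E` and by the abelian `M`, hence normal; so it is
$1$ or `M`. If it is $1$, then $[E,C_M(\alpha)]\le E\cap M=1$, so $C_M(\alpha)$ is central and, by
minimality, $1$ or `M`. In the first case Engel commutators fill `M`; in the second
$G=EC_G(\alpha)$. -/
theorem autEngelSubgroup_eq_top_of_minimal_abelian {n : ℕ} {G : Type u} [Group G] [Finite G]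
    {α : MulAut G} (hα : autCommutator α = ⊤) {M : Subgroup G} [hMn : M.Normal]
    (hM : M.map α.toMonoidHom = M) (hcomm : ∀ x ∈ M, ∀ y ∈ M, x * y = y * x)
    (hmin : ∀ K : Subgroup G, K.Normal → K.map α.toMonoidHom = K → K ≤ M → K = ⊥ ∨ K = M)
    (hE : autEngelSubgroup α n ⊔ M = ⊤) : autEngelSubgroup α n = ⊤ := by
  set E := autEngelSubgroup α n
  have hEα : E.map α.toMonoidHom = E := map_autEngelSubgroup_self α n
  suffices h : M ≤ E by rwa [sup_eq_left.2 h] at hE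
  have hnorm : (E ⊓ M).Normal := by
    rw [← Subgroup.normalizer_eq_top_iff, ← top_le_iff, ← hE]
    refine sup_le ?_ ?_
    · exact (le_inf Subgroup.le_normalizer Subgroup.le_normalizer_of_normal).trans
        (Subgroup.inf_normalizer_le_normalizer_inf)
    · intro m hm
      rw [Subgroup.mem_normalizer_iff]
      have hconj : ∀ x ∈ M, m * x * m⁻¹ = x := fun x hx => by
        rw [hcomm m hm x hx]; group
      refine fun x => ⟨fun hx => by rwa [hconj x hx.2], fun hx => ?_⟩
      have hxM : x ∈ M := by
        have := hMn.conj_mem _ hx.2 m⁻¹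
        simpa [mul_assoc] using this
      rwa [hconj x hxM] at hx
  have hinv : (E ⊓ M).map α.toMonoidHom = E ⊓ M := by
    rw [Subgroup.map_inf _ _ _ α.injective, hEα, hM]
  rcases hmin _ hnorm hinv inf_le_right with hb | ht
  · have hcent : M ⊓ fixedSubgroup α ≤ Subgroup.center G := by
      rintro c ⟨hcM, hc⟩
      have h1 : E ⊔ M ≤ Subgroup.centralizer {c} := by
        refine sup_le (fun e he => ?_) fun m hm => ?_
        · rw [Subgroup.mem_centralizer_singleton_iff]
          have h2 : e * c * e⁻¹ * c⁻¹ ∈ E ⊓ M := by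
            refine ⟨?_, M.mul_mem (hMn.conj_mem c hcM e) (M.inv_mem hcM)⟩
            have h3 := (Subgroup.mem_normalizer_iff.1 (fixedSubgroup_le_normalizer α n hc) e⁻¹).1
              (inv_mem he)
            have := mul_mem he h3
            simpa [mul_assoc] using this
          rw [hb, Subgroup.mem_bot, mul_inv_eq_one, mul_inv_eq_iff_eq_mul] at h2
          exact h2
        · rw [Subgroup.mem_centralizer_singleton_iff]
          exact hcomm m hm c hcM
      rw [hE] at h1
      exact Subgroup.mem_center_iff.2 fun g =>
        Subgroup.mem_centralizer_singleton_iff.1 (h1 (Subgroup.mem_top g))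
    have hfix : (M ⊓ fixedSubgroup α).map α.toMonoidHom = M ⊓ fixedSubgroup α := by
      ext x
      constructor
      · rintro ⟨y, hy, rfl⟩
        have hy' : α y = y := hy.2
        exact (show α y ∈ _ by rwa [hy'])
      · exact fun hx => ⟨x, hx, hx.2⟩
    have hfn : (M ⊓ fixedSubgroup α).Normal := ⟨fun x hx g => by
      rw [Subgroup.mem_center_iff.1 (hcent hx) g, mul_inv_cancel_right]
      exact hx⟩
    rcases hmin _ hfn hfix inf_le_left with h | h
    · exact le_autEngelSubgroup_of_fixedSubgroup_inf_eq_bot n hM h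
    · have htop : E = ⊤ := autEngelSubgroup_eq_top_of_sup_fixedSubgroup n hα
        (top_le_iff.1 (hE ▸ sup_le_sup_left (inf_eq_left.1 h) E))
      rw [htop]
      exact le_top
  · exact inf_eq_right.1 ht

theorem autEngelSubgroup_eq_top {n : ℕ} (hS : EngelGeneratesSimpleProducts.{u} n)
    {G : Type u} [Group G] [Finite G] (α : MulAut G) (hα : autCommutator α = ⊤) :
    autEngelSubgroup α n = ⊤ := by
  induction hc : Nat.card G using Nat.strong_induction_on generalizing G with
  | _ c ih =>
    rcases subsingleton_or_nontrivial G with hs | hs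
    · exact Subsingleton.elim _ _
    have hquot : ∀ M : Subgroup G, M.Normal → M.map α.toMonoidHom = M → M ≠ ⊥ →
        autEngelSubgroup α n ⊔ M = ⊤ := by
      intro M hMn hM hne
      let f := QuotientGroup.mk' M
      have hf : Function.Surjective f := QuotientGroup.mk'_surjective M
      let β : MulAut (G ⧸ M) := QuotientGroup.congr M M α hM
      have hfβ : ∀ x, f (α x) = β (f x) := fun _ => rfl
      have h1 : autEngelSubgroup β n = ⊤ := by
        refine ih (Nat.card (G ⧸ M)) ?_ β ?_ rfl
        · rw [← hc, ← Subgroup.index_eq_card, ← Subgroup.index_mul_card M]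
          have h1 := (Subgroup.one_lt_card_iff_ne_bot M).2 hne
          have h2 : 0 < M.index := Nat.pos_of_ne_zero Subgroup.index_ne_zero_of_finite
          nlinarith
        · rw [autCommutator_eq_autEngelSubgroup, ← map_autEngelSubgroup_eq f hf hfβ,
            ← autCommutator_eq_autEngelSubgroup, hα, Subgroup.map_top_of_surjective f hf]
      rw [← map_autEngelSubgroup_eq f hf hfβ] at h1
      have h2 := congrArg (Subgroup.comap f) h1
      rwa [Subgroup.comap_map_eq, QuotientGroup.ker_mk', Subgroup.comap_top] at h2
    have hFα : (fitting G).map α.toMonoidHom = fitting G :=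
      Subgroup.characteristic_iff_map_eq.1
        isFittingFormation_isNilpotent.radical_characteristic α
    by_cases hF : fitting G = ⊥
    · refine autEngelSubgroup_eq_top_of_fitting_eq_bot hS hα hF
        (hquot _ (genFitting_normal G) ?_ (genFitting_ne_bot G))
      rw [genFitting_eq_radical]
      exact Subgroup.characteristic_iff_map_eq.1
        isFittingFormation_isQuasinilpotent.radical_characteristic α
    -- A minimal invariant normal subgroup is sought inside $Z(F(G))$ so that it is abelian.
    · let Z : Subgroup G := (Subgroup.center (fitting G)).map (fitting G).subtype
      have hZn : Z.Normal := ConjAct.normal_of_characteristic_of_normal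
      have hZα : Z.map α.toMonoidHom = Z := map_map_subtype_of_characteristic α _ hFα _
      have hZne : Z ≠ ⊥ := by
        have : Nontrivial (fitting G) := (Subgroup.nontrivial_iff_ne_bot _).2 hF
        have := isNilpotent_fitting G
        rw [Ne, Subgroup.map_eq_bot_iff_of_injective _ (fitting G).subtype_injective]
        exact Group.IsNilpotent.center_ne_bot _
      obtain ⟨M, hM⟩ := (Set.toFinite {M : Subgroup G | M.Normal ∧ M.map α.toMonoidHom = M ∧
        M ≠ ⊥ ∧ M ≤ Z}).exists_minimal ⟨Z, hZn, hZα, hZne, le_rfl⟩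
      have hMn := hM.prop.1
      refine autEngelSubgroup_eq_top_of_minimal_abelian hα hM.prop.2.1 ?_ ?_
        (hquot M hMn hM.prop.2.1 hM.prop.2.2.1)
      · intro x hx y hy
        obtain ⟨x, -, rfl⟩ := hM.prop.2.2.2 hx
        obtain ⟨y, hy', rfl⟩ := hM.prop.2.2.2 hy
        exact congrArg Subtype.val (Subgroup.mem_center_iff.1 hy' x)
      · intro K hKn hKα hKM
        rw [or_iff_not_imp_left]
        intro hne
        exact le_antisymm hKM
          (hM.le_of_le ⟨hKn, hKα, hne, hKM.trans hM.prop.2.2.2⟩ hKM)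

/-! ### Iterated commutator subgroups with an automorphism -/

/-- `[K, α]`, the subgroup generated by all `[x, α]`, `x ∈ K`. -/
def commutatorWith {G : Type u} [Group G] (α : MulAut G) (K : Subgroup G) : Subgroup G :=
  Subgroup.closure ((fun x => x⁻¹ * α x) '' (K : Set G))

/-- `[G, α, …, α]` with `α` repeated `i` times. -/
def iterCommutator {G : Type u} [Group G] (α : MulAut G) (i : ℕ) : Subgroup G :=
  (commutatorWith α)^[i] ⊤

section IterCommutator

variable {G H : Type u} [Group G] [Group H] {α : MulAut G} {β : MulAut H}

theorem map_commutatorWith (f : G →* H) (hf : ∀ x, f (α x) = β (f x)) (K : Subgroup G) :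
    (commutatorWith α K).map f = commutatorWith β (K.map f) := by
  rw [commutatorWith, commutatorWith, MonoidHom.map_closure, Set.image_image, Subgroup.coe_map,
    Set.image_image]
  simp [hf]

theorem le_normalizer_of_conj_mem {K L : Subgroup G} (h : ∀ k ∈ K, ∀ l ∈ L, k * l * k⁻¹ ∈ L) :
    K ≤ Subgroup.normalizer (L : Set G) := by
  intro k hk
  rw [Subgroup.mem_normalizer_iff]
  refine fun x => ⟨h k hk x, fun hx => ?_⟩
  have := h k⁻¹ (inv_mem hk) _ hx
  simpa [mul_assoc] using this

theorem inv_mul_apply_mem_commutatorWith {K : Subgroup G} {x : G} (hx : x ∈ K) :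
    x⁻¹ * α x ∈ commutatorWith α K :=
  Subgroup.subset_closure ⟨x, hx, rfl⟩

theorem le_normalizer_commutatorWith (α : MulAut G) (K : Subgroup G) :
    K ≤ Subgroup.normalizer (commutatorWith α K : Set G) := by
  refine le_normalizer_of_conj_mem fun k hk => ?_
  suffices h : commutatorWith α K ≤ (commutatorWith α K).comap (MulAut.conj k).toMonoidHom from
    fun l hl => h hl
  refine (Subgroup.closure_le _).2 ?_
  rintro _ ⟨x, hx, rfl⟩
  -- The identity is $k[x,\alpha]k^{-1}=[xk^{-1},\alpha]\,[k^{-1},\alpha]^{-1}$.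
  have h1 := mul_mem (inv_mul_apply_mem_commutatorWith (α := α) (mul_mem hx (inv_mem hk)))
    (inv_mem (inv_mul_apply_mem_commutatorWith (α := α) (inv_mem hk)))
  simpa [mul_assoc] using h1

theorem commutatorWith_le {K : Subgroup G} (hK : K.map α.toMonoidHom = K) :
    commutatorWith α K ≤ K := by
  refine (Subgroup.closure_le _).2 ?_
  rintro _ ⟨x, hx, rfl⟩
  have h1 : α x ∈ K := by
    rw [← hK]
    exact Subgroup.mem_map_of_mem _ hx
  exact mul_mem (inv_mem hx) h1

theorem iterCommutator_succ (α : MulAut G) (i : ℕ) :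
    iterCommutator α (i + 1) = commutatorWith α (iterCommutator α i) :=
  Function.iterate_succ_apply' _ _ _

theorem map_iterCommutator (f : G →* H) (hs : Function.Surjective f)
    (hf : ∀ x, f (α x) = β (f x)) (i : ℕ) :
    (iterCommutator α i).map f = iterCommutator β i := by
  induction i with
  | zero => exact Subgroup.map_top_of_surjective f hs
  | succ i ih => rw [iterCommutator_succ, iterCommutator_succ, map_commutatorWith f hf, ih]

theorem map_iterCommutator_self (α : MulAut G) (i : ℕ) :
    (iterCommutator α i).map α.toMonoidHom = iterCommutator α i :=
  map_iterCommutator α.toMonoidHom α.surjective (fun _ => rfl) i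

theorem iterCommutator_succ_le (α : MulAut G) (i : ℕ) :
    iterCommutator α (i + 1) ≤ iterCommutator α i := by
  rw [iterCommutator_succ]
  exact commutatorWith_le (map_iterCommutator_self α i)

theorem iterCommutator_le_normalizer (α : MulAut G) (i : ℕ) :
    iterCommutator α i ≤ Subgroup.normalizer (iterCommutator α (i + 1) : Set G) := by
  rw [iterCommutator_succ]
  exact le_normalizer_commutatorWith α _

theorem isSubnormal_iterCommutator (α : MulAut G) (i : ℕ) : (iterCommutator α i).IsSubnormal := by
  induction i with
  | zero => exact Subgroup.IsSubnormal.top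
  | succ i ih =>
    exact .step _ _ (iterCommutator_succ_le α i) ih
      ((Subgroup.normal_subgroupOf_iff_le_normalizer (iterCommutator_succ_le α i)).2
        (iterCommutator_le_normalizer α i))

theorem exists_iterCommutator_succ_eq [Finite G] (α : MulAut G) :
    ∃ m, iterCommutator α (m + 1) = iterCommutator α m := by
  obtain ⟨_, hM⟩ := (Set.toFinite (Set.range (iterCommutator α))).exists_minimal
    (Set.range_nonempty _)
  obtain ⟨m, rfl⟩ := hM.prop
  exact ⟨m, le_antisymm (iterCommutator_succ_le α m)
    (hM.le_of_le ⟨m + 1, rfl⟩ (iterCommutator_succ_le α m))⟩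

/-- The stationary term $K$ satisfies $K=[K,\alpha]$, so statement 3 applies to the restriction of
`α` to $K$. -/
theorem iterCommutator_le_autEngelSubgroup {n : ℕ} (hS : EngelGeneratesSimpleProducts.{u} n)
    [Finite G] {m : ℕ} (hm : iterCommutator α (m + 1) = iterCommutator α m) :
    iterCommutator α m ≤ autEngelSubgroup α n := by
  set K := iterCommutator α m with hKdef
  let γ := restrictAut α K (map_iterCommutator_self α m)
  have hγ : ∀ x : K, K.subtype (γ x) = α (K.subtype x) := fun _ => rfl
  have h1 : commutatorWith γ ⊤ = ⊤ := by
    apply Subgroup.map_injective K.subtype_injective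
    rw [map_commutatorWith K.subtype hγ, ← MonoidHom.range_eq_map, Subgroup.range_subtype,
      hKdef, ← iterCommutator_succ, hm]
  have h2 : autCommutator γ = ⊤ := by
    rw [autCommutator, ← Set.image_univ, ← Subgroup.coe_top]
    exact h1
  have h3 := map_autEngelSubgroup_le K.subtype hγ n
  rwa [autEngelSubgroup_eq_top hS γ h2, ← MonoidHom.range_eq_map, Subgroup.range_subtype] at h3

end IterCommutator

/-! ### Engel subgroups of elements -/

section Element

variable {G : Type u} [Group G]

theorem engelSubgroup_eq_autEngelSubgroup (g : G) (n : ℕ) :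
    engelSubgroup g n = autEngelSubgroup (MulAut.conj g⁻¹) n := by
  have h : (fun y : G => y⁻¹ * g⁻¹ * y * g) = fun y : G => y⁻¹ * MulAut.conj g⁻¹ y := by
    funext y
    simp [mul_assoc]
  have h1 : engelComm g n = autEngelComm (MulAut.conj g⁻¹) n := by
    funext x
    rw [engelComm, autEngelComm, h]
  rw [engelSubgroup, autEngelSubgroup, h1]

theorem isSubnormal_iterCommutator_sup_zpowers (g : G) (i : ℕ) :
    (iterCommutator (MulAut.conj g⁻¹) i ⊔ Subgroup.zpowers g).IsSubnormal := by
  induction i with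
  | zero =>
    have : iterCommutator (MulAut.conj g⁻¹) 0 = ⊤ := rfl
    rw [this, top_sup_eq]
    exact Subgroup.IsSubnormal.top
  | succ i ih =>
    have hle := sup_le_sup_right (iterCommutator_succ_le (MulAut.conj g⁻¹) i)
      (Subgroup.zpowers g)
    refine .step _ _ hle ih ((Subgroup.normal_subgroupOf_iff_le_normalizer hle).2 ?_)
    set L := iterCommutator (MulAut.conj g⁻¹) (i + 1) ⊔ Subgroup.zpowers g
    refine sup_le (le_normalizer_of_conj_mem fun k hk => ?_)
      (le_sup_right.trans Subgroup.le_normalizer)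
    suffices h : L ≤ L.comap (MulAut.conj k).toMonoidHom from fun l hl => h hl
    refine sup_le (fun x hx => ?_) ?_
    · exact (le_sup_left : _ ≤ L) ((Subgroup.mem_normalizer_iff.1
        (iterCommutator_le_normalizer _ i hk) x).1 hx)
    · rw [Subgroup.zpowers_le]
      -- Conjugates of `g` are handled by $kgk^{-1}=g\,[k^{-1},g]^{-1}$, where the commutator lies
      -- in the next term of the chain.
      have h1 := inv_mul_apply_mem_commutatorWith (α := MulAut.conj g⁻¹) (inv_mem hk)
      rw [← iterCommutator_succ] at h1
      have h2 : g ∈ L := (le_sup_right : _ ≤ L) (Subgroup.mem_zpowers g)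
      have h3 := mul_mem h2 (inv_mem ((le_sup_left : _ ≤ L) h1))
      simpa [mul_assoc] using h3

/-- If `E_n(g)` belongs to a Fitting formation, then `g` belongs to the Fitting subgroup modulo
the corresponding radical. -/
theorem mk_mem_fitting_of_engelSubgroup {n : ℕ} (hS : EngelGeneratesSimpleProducts.{u} n)
    [Finite G] {C : ∀ (G : Type u) [Group G], Prop} (hC : IsFittingFormation C) (g : G)
    (h : C (engelSubgroup g n)) :
    QuotientGroup.mk' (radical C G) g ∈ fitting (G ⧸ radical C G) := by
  let α := MulAut.conj g⁻¹
  obtain ⟨m, hm⟩ := exists_iterCommutator_succ_eq α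
  have hsub := isSubnormal_iterCommutator α m
  have hle : iterCommutator α m ≤ engelSubgroup g n := by
    rw [engelSubgroup_eq_autEngelSubgroup]
    exact iterCommutator_le_autEngelSubgroup hS hm
  have hCH : C (iterCommutator α m) :=
    hC.of_mulEquiv (Subgroup.subgroupOfEquivOfLe hle) (hC.of_isSubnormal hsub.subgroupOf h)
  have hR : iterCommutator α m ≤ radical C G := hC.le_radical_of_isSubnormal hsub hCH
  let f := QuotientGroup.mk' (radical C G)
  -- The stationary term lies in the radical, so modulo the radical the chain for the image of `g`
  -- ends in $1$, and the image generates a subnormal cyclic subgroup.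
  have hbot : iterCommutator (MulAut.conj (f g)⁻¹) m = ⊥ := by
    rw [← map_iterCommutator (α := α) f (QuotientGroup.mk'_surjective _) (fun x => by simp [α]),
      Subgroup.map_eq_bot_iff, QuotientGroup.ker_mk']
    exact hR
  have h1 := isSubnormal_iterCommutator_sup_zpowers (f g) m
  rw [hbot, bot_sup_eq] at h1
  exact le_fitting_of_isSubnormal h1 (isNilpotent_of_mul_comm fun a b => mul_comm' a b)
    (Subgroup.mem_zpowers _)

end Element

end EngelSink

/-! ### The three statements -/

theorem mainTheorem7 {G : Type u} [Group G] [Finite G] (n : ℕ) (hn : 0 < n)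
    (hS : EngelGeneratesSimpleProducts.{u} n) :
    (∀ (g : G) (k : ℕ),
      genFittingHeight (engelSubgroup g n) = k → g ∈ genFittingSeries G (k + 1)) ∧
    (∀ (g : G) (k : ℕ),
      nonsolubleLength (engelSubgroup g n) = k → g ∈ nonsolubleRadical G k) ∧
    (∀ α : MulAut G, autCommutator α = ⊤ → autEngelSubgroup α n = ⊤) := by
  refine ⟨?_, ?_, fun α hα => autEngelSubgroup_eq_top hS α hα⟩
  · rintro g k rfl
    have hC := isFittingFormation_genFittingClass.{u} (genFittingHeight (engelSubgroup g n))
    have h := mk_mem_fitting_of_engelSubgroup hS hC g (genFittingClass_genFittingHeight _)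
    rw [genFittingSeries_eq_radical, GenFittingClass,
      hC.radical_extensionClass isFittingFormation_isQuasinilpotent, ← genFitting_eq_radical]
    exact (le_sup_left : fitting _ ≤ genFitting _) h
  · intro g k hk
    have h := mk_mem_fitting_of_engelSubgroup hS (isFittingFormation_nonsolubleClass k) g
      ((nonsolubleLength_le_iff _ k).1 hk.le)
    rw [fitting_quotient_radical_nonsolubleClass, Subgroup.mem_bot] at h
    rw [nonsolubleRadical_eq_radical]
    exact (QuotientGroup.eq_one_iff g).1 h
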